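/- Monoid varieties are classes of monoids defined by sets of identities $\mathbf u\approx\mathbf v$ between words over a countably infinite alphabet. The lattice $\mathfrak L(\mathbf V)$ consists of all subvarieties of a variety $\mathbf V$, ordered by inclusion. For a word $\mathbf w$, let $M(\mathbf w)$ be the monoid consisting of all factors (contiguous subwords, including the empty word $1$) of $\mathbf w$ and a zero element $0$, where the product of two factors $\mathbf u,\mathbf v$ is $\mathbf u\mathbf v$ if this is again a factor of $\mathbf w$, and $0$ otherwise. Let $\mathbf M(\mathbf w)$ be the variety generated by $M(\mathbf w)$. For $n,m,k\in\mathbb N_0=\{0,1,2,\dots\}$ and a permutation $\tau$ of $\{1,\dots,n+m+k\}$, written on the right of its arguments, put $$ \mathbf c_{n,m,k}[\tau]=\biggl(\prod_{i=1}^n z_it_i\biggr)\,xyt\,\biggl(\prod_{i=n+1}^{n+m} z_it_i\biggr)\,x\,\biggl(\prod_{i=1}^{n+m+k} z_{i\tau}\biggr)\,y\,\biggl(\prod_{i=n+m+1}^{n+m+k} t_iz_i\biggr), $$ where $x,y,t,z_1,z_2,\dots,t_1,t_2,\dots$ are pairwise distinct letters. For $p,q\in\mathbb N_0$, let $S_{p,q}$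 be the set of all permutations $\rho$ of $\{1,\dots,p+q\}$ such that, for every $i=1,\dots,p+q-1$, exactly one of the numbers $i\rho$ and $(i+1)\rho$ is at most $p$. **Proposition.** For all $n,m\in\mathbb N_0$ and $\rho\in S_{n+m,n+m+1}$, the lattice $\mathfrak L\bigl(\mathbf M(\mathbf c_{n,m,n+m+1}[\rho])\bigr)$ is not modular, and so not distributive. -/

import Mathlib

namespace MonVar

/-- The countably infinite alphabet: three letters `x`, `y`, `t` and two sequences
`z 0, z 1, …` and `s 0, s 1, …` (the letters usually written `z_i` and `t_i`, here
indexed from `0`). -/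
inductive Letter : Type
  | x : Letter
  | y : Letter
  | t : Letter
  | z : ℕ → Letter
  | s : ℕ → Letter
  deriving DecidableEq

/-- Words: elements of the free monoid over the alphabet. -/
abbrev Word : Type := FreeMonoid Letter

/-- The monoid `M` satisfies the identity `e.1 ≈ e.2`: every substitution of elements
of `M` for letters gives both sides the same value. -/
def Satisfies (M : MonCat.{0}) (e : Word × Word) : Prop :=
  ∀ φ : Letter → M, FreeMonoid.lift φ e.1 = FreeMonoid.lift φ e.2

/-- The class of all monoids satisfying every identity in `E`. -/
def models (E : Set (Word × Word)) : Set MonCat.{0} :=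
  {M | ∀ e ∈ E, Satisfies M e}

/-- A monoid variety: a class of monoids defined by some set of identities. -/
@[ext]
structure Variety where
  carrier : Set MonCat.{0}
  equational : ∃ E : Set (Word × Word), carrier = models E

namespace Variety

/-- Varieties are ordered by inclusion. -/
instance : PartialOrder Variety :=
  PartialOrder.lift Variety.carrier fun _ _ h => Variety.ext h

/-- The infimum of a set of varieties is their intersection. -/
instance : InfSet Variety where
  sInf S :=
    { carrier := {M | ∀ V ∈ S, M ∈ V.carrier}
      equational := by
        refine ⟨{e | ∃ V ∈ S, ∀ M ∈ V.carrier, Satisfies M e}, ?_⟩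
        ext M
        constructor
        · rintro h e ⟨V, hV, he⟩
          exact he M (h V hV)
        · intro h V hV
          obtain ⟨E, hE⟩ := V.equational
          rw [hE]
          intro e he
          refine h e ⟨V, hV, fun N hN => ?_⟩
          rw [hE] at hN
          exact hN e he }

/-- The lattice of all monoid varieties: meet is intersection, and the join of a family
is the least variety containing all its members. -/
instance : CompleteLattice Variety :=
  completeLatticeOfInf Variety fun S => by
    constructor
    · intro V hV M hM
      exact hM V hV
    · intro U hU M hM V hV
      exact hU hV hM

/-- The variety generated by a monoid: the least variety containing it. -/
def generatedBy (M : MonCat.{0}) : Variety :=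
  sInf {V | M ∈ V.carrier}

/-- The lattice of subvarieties of `V`. -/
abbrev Subvarieties (V : Variety) : Type 1 := Set.Iic V

end Variety

/-- `w` is a factor (contiguous subword) of some word in `W`. The empty word is always
admitted; this is automatic as soon as `W` is nonempty. -/
def IsFactor (W : Set Word) (w : Word) : Prop :=
  w = 1 ∨ ∃ u ∈ W, ∃ a b : Word, a * w * b = u

theorem IsFactor.left {W : Set Word} {u v : Word} (h : IsFactor W (u * v)) :
    IsFactor W u := by
  rcases h with h | ⟨w, hw, a, b, rfl⟩
  · exact Or.inl (List.append_eq_nil_iff.mp h).1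
  · exact Or.inr ⟨_, hw, a, v * b, by simp only [mul_assoc]⟩

theorem IsFactor.right {W : Set Word} {u v : Word} (h : IsFactor W (u * v)) :
    IsFactor W v := by
  rcases h with h | ⟨w, hw, a, b, rfl⟩
  · exact Or.inl (List.append_eq_nil_iff.mp h).2
  · exact Or.inr ⟨_, hw, a * u, b, by simp only [mul_assoc]⟩

/-- The underlying set of the factor monoid `M(W)`: the factors of words in `W`, together
with a zero element `none`. -/
def FactorMonoid (W : Set Word) : Type := Option {w : Word // IsFactor W w}

namespace FactorMonoid

open Classical in
/-- The class of a word in `M(W)`: itself if it is a factor, and zero otherwise. -/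
noncomputable def ofWord (W : Set Word) (w : Word) : FactorMonoid W :=
  if h : IsFactor W w then some ⟨w, h⟩ else none

/-- The product of two factors is their concatenation if that is again a factor, and zero
otherwise; products with zero are zero. -/
noncomputable def mul {W : Set Word} : FactorMonoid W → FactorMonoid W → FactorMonoid W
  | some u, some v => ofWord W (u.1 * v.1)
  | some _, none => none
  | none, _ => none

theorem mul_ofWord {W : Set Word} (u : {w : Word // IsFactor W w}) (v : Word) :
    mul (some u) (ofWord W v) = ofWord W (u.1 * v) := by
  by_cases h : IsFactor W v
  · rw [show ofWord W v = some ⟨v, h⟩ from dif_pos h]; rfl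
  · rw [show ofWord W v = none from dif_neg h,
      show ofWord W (u.1 * v) = none from dif_neg fun h2 => h h2.right]; rfl

theorem ofWord_mul {W : Set Word} (u : Word) (v : {w : Word // IsFactor W w}) :
    mul (ofWord W u) (some v) = ofWord W (u * v.1) := by
  by_cases h : IsFactor W u
  · rw [show ofWord W u = some ⟨u, h⟩ from dif_pos h]; rfl
  · rw [show ofWord W u = none from dif_neg h,
      show ofWord W (u * v.1) = none from dif_neg fun h2 => h h2.left]; rfl

theorem mul_none {W : Set Word} (a : FactorMonoid W) : mul a none = none := by
  cases a <;> rfl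

noncomputable instance (W : Set Word) : Monoid (FactorMonoid W) where
  mul := mul
  one := some ⟨1, Or.inl rfl⟩
  mul_assoc := by
    intro a b c
    change mul (mul a b) c = mul a (mul b c)
    rcases a with _ | u
    · rfl
    rcases b with _ | v
    · rfl
    rcases c with _ | w
    · exact mul_none _
    · change mul (ofWord W (u.1 * v.1)) (some w) = mul (some u) (ofWord W (v.1 * w.1))
      rw [ofWord_mul, mul_ofWord, mul_assoc]
  one_mul := by
    intro a
    rcases a with _ | u
    · rfl
    · change ofWord W (1 * u.1) = some u
      rw [one_mul]
      exact dif_pos u.2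
  mul_one := by
    intro a
    rcases a with _ | u
    · rfl
    · change ofWord W (u.1 * 1) = some u
      rw [mul_one]
      exact dif_pos u.2

end FactorMonoid

/-- The variety generated by the factor monoid `M(W)`. -/
noncomputable def factorVariety (W : Set Word) : Variety :=
  Variety.generatedBy (MonCat.of (FactorMonoid W))

/-- The word `(∏_{i<n} z_i t_i) x y t (∏_{n≤i<n+m} z_i t_i) x (∏_{i<n+m+k} z_{τ(i)}) y
(∏_{n+m≤i<n+m+k} t_i z_i)`, with all products taken in increasing order of `i`.
(`List.range' a l` is the list `a, a+1, …, a+l-1`.) -/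
def cWord (n m k : ℕ) (τ : Equiv.Perm (Fin (n + m + k))) : Word :=
  FreeMonoid.ofList <|
    (List.range' 0 n).flatMap (fun i => [Letter.z i, Letter.s i]) ++
    [Letter.x, Letter.y, Letter.t] ++
    (List.range' n m).flatMap (fun i => [Letter.z i, Letter.s i]) ++
    [Letter.x] ++
    List.ofFn (fun i : Fin (n + m + k) => Letter.z (τ i)) ++
    [Letter.y] ++
    (List.range' (n + m) k).flatMap (fun i => [Letter.s i, Letter.z i])

/-- `(p,q)`-permutations: permutations `ρ` of `{0, …, p+q-1}` such that, of any two
consecutive values `ρ(i)`, `ρ(i+1)`, exactly one lies among the first `p` points. -/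
def IsAlternatingPerm (p q : ℕ) (ρ : Equiv.Perm (Fin (p + q))) : Prop :=
  ∀ i j : Fin (p + q), (j : ℕ) = i + 1 →
    ((ρ i : ℕ) < p ∧ p ≤ (ρ j : ℕ)) ∨ ((ρ j : ℕ) < p ∧ p ≤ (ρ i : ℕ))

end MonVar

/-! Let V be the variety generated by the factor monoid of the word c, and N = 2(n+m)+1 the length
of its permuted block. The modular law fails because of four words `full e d`. Each contains two
copies of c on disjoint alphabets: x, y, t of the first copy correspond to z = z_{2N+5}, w =
z_{2N+6}, s_{2N+5} in the second. Here e is an order of the adjacent first occurrences of x, y, and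
d is one for z, w; the pair d stands just after the second x.

Write w₁ = (xy, wz), w₂ = (yx, wz), w₃ = (xy, zw), w₄ = (yx, zw). Let Z be cut out of V by w₁ ≈ w₂,
X out of Z by w₃ ≈ w₄, and Y out of V by w₁ ≈ w₃ and w₂ ≈ w₄. In Y ∧ Z one has w₃ ≈ w₁ ≈ w₂ ≈ w₄, so
X ∨ (Y ∧ Z) satisfies w₃ ≈ w₄. The syntactic monoid of {w₃} violates w₃ ≈ w₄, yet it lies in (X ∨ Y)
∧ Z: it belongs to the join because {w₃} = {w₃, w₄} ∩ {w₁, w₃}, where the two languages have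
syntactic monoids in X and in Y (`Variety.exists_not_sup_inf_le`).

Membership in V needs these languages to be closed under the identities of V. Substitutions into
factors of c detect the relative order of two adjacent occurrences unless both are first or both are
second ones (`FactorEq.filter_eq_of_adjacent`). As ρ alternates, first and second occurrences
alternate in the permuted blocks, and the test words are built so that e and d are the only
exceptions. Hence the identities of V can change only e and d (`FactorEq.eq_full`), and projecting
onto a copy of c forbids turning xy into yx or zw into wz.

Membership in X, Y, Z needs rigidity of the exchange identities. An instance of the exchange of x
and y that changes a test word does so at e, and only if d is the same in the identity and in the
test word (`swap_x_instance`); an instance of the exchange of z and w can change only d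
(`swap_z_instance`). The asymmetry between these two statements is what breaks modularity. -/

namespace MonVar
open List

/-! ### Words recovered from pairs of letters and from deletions -/

section ListLemmas
variable {α β : Type*} [DecidableEq α]

/-- If the first letters differed, the first letter c of v would have some letter p immediately
before its first occurrence in w. Restricted to {p, c}, the word v begins with c and w with p. -/
theorem eq_of_filter_adjacent {w v : List α} (hp : v.Perm w)
    (h : ∀ A p q D, w = A ++ p :: q :: D →
      v.filter (fun r => r = p ∨ r = q) = w.filter (fun r => r = p ∨ r = q)) : v = w := by
  induction w generalizing v with
  | nil => exact hp.eq_nil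
  | cons a w ih =>
    rcases v with _ | ⟨c, v⟩
    · exact absurd hp.symm.eq_nil (by simp)
    have hca : c = a := by
      by_contra hne
      have hc : c ∈ w := by
        have : c ∈ a :: w := hp.subset (by simp)
        simpa [hne] using this
      obtain ⟨A, D, rfl, hA⟩ := List.eq_append_cons_of_mem hc
      obtain ⟨A', p, hA'⟩ : ∃ A' p, a :: A = A' ++ [p] :=
        ⟨_, _, (List.dropLast_append_getLast (by simp : a :: A ≠ [])).symm⟩
      have hcA : c ∉ A' ++ [p] := by rw [← hA']; simp [-Bool.decide_or, -decide_not, hne, hA]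
      have e : a :: (A ++ c :: D) = A' ++ p :: c :: D := by
        rw [← List.cons_append, hA']; simp
      have := h A' p c D e
      rw [e] at this
      have hpc : c ≠ p := fun hh => hcA (by simp [-Bool.decide_or, -decide_not, hh])
      cases hf : A'.filter (fun r => r = p ∨ r = c) with
      | nil =>
        simp [-Bool.decide_or, -decide_not, hf] at this
        exact hpc this.1
      | cons b l =>
        have hb : b ∈ A' := (List.mem_filter.mp (hf ▸ List.mem_cons_self : b ∈ A'.filter _)).1
        simp [-Bool.decide_or, -decide_not, hf] at this
        exact hcA (by simp [-Bool.decide_or, -decide_not, this.1, hb])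
    subst hca
    rw [ih (List.Perm.cons_inv hp)]
    intro A p q D e
    have := h (c :: A) p q D (by simp [-Bool.decide_or, -decide_not, e])
    simp only [List.filter_cons] at this
    split_ifs at this
    · exact (List.cons.inj this).2
    · exact this

theorem flatMap_eq_filter_flatMap {l : List α} {φ : α → List β} {S : α → Prop}
    [DecidablePred S] (h : ∀ r ∈ l, ¬ S r → φ r = []) :
    l.flatMap φ = (l.filter S).flatMap φ := by
  induction l with
  | nil => rfl
  | cons a l ih =>
    rw [List.flatMap_cons, ih fun r hr => h r (by simp [-Bool.decide_or, -decide_not, hr])]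
    by_cases ha : S a
    · simp [-Bool.decide_or, -decide_not, ha]
    · simp [-Bool.decide_or, -decide_not, ha, h a (by simp) ha]

theorem filter_flatMap_eq_map {φ : α → List α} {p q p' q' : α}
    (hp : (φ p).filter (fun r => r = p' ∨ r = q') = [p'])
    (hq : (φ q).filter (fun r => r = p' ∨ r = q') = [q'])
    (hr : ∀ r, r ≠ p → r ≠ q → (φ r).filter (fun r => r = p' ∨ r = q') = [])
    (l : List α) :
    (l.flatMap φ).filter (fun r => r = p' ∨ r = q') =
      (l.filter (fun r => r = p ∨ r = q)).map (fun r => if r = p then p' else q') := by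
  induction l with
  | nil => rfl
  | cons a l ih =>
    rw [List.flatMap_cons, List.filter_append, ih]
    by_cases h1 : a = p
    · subst h1; simp [-Bool.decide_or, -decide_not, hp]
    by_cases h2 : a = q
    · subst h2; simp [-Bool.decide_or, -decide_not, hq, h1]
    · simp [-Bool.decide_or, -decide_not, hr a h1 h2, h1, h2]

/-- Each p contributes exactly one marker p' to the image, each q one marker q', and no other letter
contributes a marker. The markers in the image therefore spell out the order of p and q. -/
theorem filter_eq_of_flatMap_eq {φ : α → List α} {p q p' q' : α} (hpq : p' ≠ q')
    (hp : (φ p).filter (fun r => r = p' ∨ r = q') = [p'])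
    (hq : (φ q).filter (fun r => r = p' ∨ r = q') = [q'])
    (hr : ∀ r, r ≠ p → r ≠ q → (φ r).filter (fun r => r = p' ∨ r = q') = [])
    {u v : List α} (h : v.flatMap φ = u.flatMap φ) :
    v.filter (fun r => r = p ∨ r = q) = u.filter (fun r => r = p ∨ r = q) := by
  have key := congrArg (fun l => l.filter (fun r => r = p' ∨ r = q')) h
  simp only [filter_flatMap_eq_map hp hq hr] at key
  have key2 := congrArg (List.map (fun r => if r = p' then p else q)) key
  have inv : ∀ l : List α, ((l.filter (fun r => r = p ∨ r = q)).map
      (fun r => if r = p then p' else q')).map (fun r => if r = p' then p else q) =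
      l.filter (fun r => r = p ∨ r = q) := by
    intro l
    rw [List.map_map]
    conv_rhs => rw [← List.map_id (l.filter (fun r => r = p ∨ r = q))]
    apply List.map_congr_left
    intro r hr
    have := (List.mem_filter.mp hr).2
    simp only [decide_eq_true_eq] at this
    by_cases h1 : r = p
    · simp [-Bool.decide_or, -decide_not, h1]
    · have h2 : r = q := by tauto
      subst h2
      simp [-Bool.decide_or, -decide_not, h1, hpq.symm]
  rwa [inv, inv] at key2

theorem append_cons_unique {A A' B B' : List α} {p : α} (h : A ++ p :: B = A' ++ p :: B')
    (hA : p ∉ A) (hA' : p ∉ A') : A = A' ∧ B = B' := by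
  induction A generalizing A' with
  | nil =>
    cases A' with
    | nil => simpa using h
    | cons a A' => simp [-Bool.decide_or, -decide_not] at h hA'; exact absurd h.1 hA'.1
  | cons a A ih =>
    cases A' with
    | nil => simp [-Bool.decide_or, -decide_not] at h hA; exact absurd h.1.symm hA.1
    | cons b A' =>
      simp [-Bool.decide_or, -decide_not] at h hA hA'
      obtain ⟨rfl, h⟩ := h
      obtain ⟨rfl, rfl⟩ := ih h hA.2 hA'.2
      exact ⟨rfl, rfl⟩

/-- A word in which the second occurrences of `x` and `y` are separated, as are the first ones
from the second ones, is determined up to the order of the adjacent first occurrences by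
deleting `x` and by deleting `y`. -/
theorem eq_or_eq_of_filter_ne {x y : α} (hxy : x ≠ y) {A C E D v : List α}
    (hC : C ≠ []) (hE : E ≠ []) (hx : x ∉ A ++ C ++ E ++ D) (hy : y ∉ A ++ C ++ E ++ D)
    (H1 : v.filter (fun r => r ≠ x) = A ++ y :: C ++ E ++ y :: D)
    (H2 : v.filter (fun r => r ≠ y) = A ++ x :: C ++ x :: E ++ D) :
    v = A ++ [x, y] ++ C ++ x :: E ++ y :: D ∨ v = A ++ [y, x] ++ C ++ x :: E ++ y :: D := by
  -- The word v is read from the left: each of its letters survives in at least one of the two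
  -- deletions, so their heads determine the next letter. The only ambiguous situation is `hne`,
  -- where the heads are y and x; it arises at the adjacent first occurrences.
  have strip : ∀ {A v R S : List α}, x ∉ A → y ∉ A →
      v.filter (fun r => r ≠ x) = A ++ R → v.filter (fun r => r ≠ y) = A ++ S →
      ∃ v', v = A ++ v' ∧ v'.filter (fun r => r ≠ x) = R ∧ v'.filter (fun r => r ≠ y) = S := by
    intro A
    induction A with
    | nil => intro v R S _ _ h1 h2; exact ⟨v, rfl, h1, h2⟩
    | cons a A ih =>
      intro v R S hx hy h1 h2
      rcases v with _ | ⟨c, v⟩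
      · simp [-Bool.decide_or, -decide_not] at h1
      simp [-Bool.decide_or, -decide_not] at hx hy
      by_cases c1 : c = x
      · subst c1
        simp [-Bool.decide_or, -decide_not, hxy] at h2
        exact absurd h2.1 hx.1
      by_cases c2 : c = y
      · subst c2
        simp [-Bool.decide_or, -decide_not, Ne.symm hxy] at h1
        exact absurd h1.1 hy.1
      simp [-Bool.decide_or, -decide_not, c1, c2] at h1 h2
      obtain ⟨rfl, h1⟩ := h1
      obtain ⟨v', rfl, h3⟩ := ih hx.2 hy.2 (by simpa [-Bool.decide_or, -decide_not] using h1)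
        (by simpa [-Bool.decide_or, -decide_not] using h2.2)
      exact ⟨v', rfl, h3⟩
  have hne : ∀ {v R S : List α} , v.filter (fun r => r ≠ x) = y :: R →
      v.filter (fun r => r ≠ y) = x :: S → ∃ v', (v = x :: v' ∧
      v'.filter (fun r => r ≠ x) = y :: R ∧ v'.filter (fun r => r ≠ y) = S) ∨ (v = y :: v' ∧
      v'.filter (fun r => r ≠ x) = R ∧ v'.filter (fun r => r ≠ y) = x :: S) := by
    intro v R S h1 h2
    rcases v with _ | ⟨c, v⟩
    · simp [-Bool.decide_or, -decide_not] at h1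
    by_cases c1 : c = x
    · subst c1
      simp [-Bool.decide_or, -decide_not, hxy] at h1 h2
      exact ⟨v, Or.inl ⟨rfl, by simpa [-Bool.decide_or, -decide_not] using h1,
        by simpa [-Bool.decide_or, -decide_not] using h2⟩⟩
    by_cases c2 : c = y
    · subst c2
      simp [-Bool.decide_or, -decide_not, Ne.symm hxy] at h1 h2
      exact ⟨v, Or.inr ⟨rfl, by simpa [-Bool.decide_or, -decide_not] using h1,
        by simpa [-Bool.decide_or, -decide_not] using h2⟩⟩
    simp [-Bool.decide_or, -decide_not, c1, c2] at h1
  have onex : ∀ {v S : List α} {R : List α}, R ≠ [] → y ∉ R.head? →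
      v.filter (fun r => r ≠ x) = R → v.filter (fun r => r ≠ y) = x :: S →
      ∃ v', v = x :: v' ∧ v'.filter (fun r => r ≠ x) = R ∧ v'.filter (fun r => r ≠ y) = S := by
    intro v S R hR hyR h1 h2
    rcases v with _ | ⟨c, v⟩
    · simp [-Bool.decide_or, -decide_not] at h2
    by_cases c1 : c = x
    · subst c1
      simp [-Bool.decide_or, -decide_not, hxy] at h1 h2
      exact ⟨v, rfl, by simpa [-Bool.decide_or, -decide_not] using h1,
        by simpa [-Bool.decide_or, -decide_not] using h2⟩
    by_cases c2 : c = y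
    · clear H1 H2 strip hne
      subst c2
      rw [← h1] at hyR
      simp [-Bool.decide_or, -decide_not, Ne.symm hxy] at hyR
    simp [-Bool.decide_or, -decide_not, c1, c2] at h2
  have oney : ∀ {v S : List α} {R : List α}, R.head? ≠ some x →
      v.filter (fun r => r ≠ x) = y :: S → v.filter (fun r => r ≠ y) = R →
      ∃ v', v = y :: v' ∧ v'.filter (fun r => r ≠ x) = S ∧ v'.filter (fun r => r ≠ y) = R := by
    intro v S R hyR h1 h2
    rcases v with _ | ⟨c, v⟩
    · simp [-Bool.decide_or, -decide_not] at h1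
    by_cases c1 : c = y
    · subst c1
      simp [-Bool.decide_or, -decide_not, Ne.symm hxy] at h1 h2
      exact ⟨v, rfl, by simpa [-Bool.decide_or, -decide_not] using h1,
        by simpa [-Bool.decide_or, -decide_not] using h2⟩
    by_cases c2 : c = x
    · clear H1 H2 strip hne onex
      subst c2
      rw [← h2] at hyR
      simp [-Bool.decide_or, -decide_not, hxy] at hyR
    simp [-Bool.decide_or, -decide_not, c1, c2] at h1
  simp only [List.mem_append, not_or] at hx hy
  have hyhead : ∀ {L R : List α}, L ≠ [] → y ∉ L → y ∉ (L ++ R).head? := by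
    intro L R hL hyL
    cases L with
    | nil => exact absurd rfl hL
    | cons a L => simp [-Bool.decide_or, -decide_not] at hyL ⊢; exact Ne.symm hyL.1
  have hxhead : ∀ {L R : List α}, L ≠ [] → x ∉ L → (L ++ R).head? ≠ some x := by
    intro L R hL hyL
    cases L with
    | nil => exact absurd rfl hL
    | cons a L => simp [-Bool.decide_or, -decide_not] at hyL ⊢; exact Ne.symm hyL.1
  have final : ∀ {v : List α}, v.filter (fun r => r ≠ x) = C ++ (E ++ y :: D) →
      v.filter (fun r => r ≠ y) = C ++ x :: (E ++ D) → v = C ++ x :: E ++ y :: D := by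
    intro v h1 h2
    obtain ⟨v, rfl, h1, h2⟩ := strip hx.1.1.2 hy.1.1.2 h1 h2
    obtain ⟨v, rfl, h1, h2⟩ := onex (by simp) (hyhead hE hy.1.2) h1 h2
    obtain ⟨v, rfl, h1, h2⟩ := strip hx.1.2 hy.1.2 h1 h2
    have hD : D.head? ≠ some x := fun hh => hx.2 (List.mem_of_mem_head? hh)
    obtain ⟨v, rfl, h1, h2⟩ := oney hD h1 h2
    have := strip (R := []) (S := []) hx.2 hy.2 (by simpa [-Bool.decide_or, -decide_not] using h1)
      (by simpa [-Bool.decide_or, -decide_not] using h2)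
    obtain ⟨v, rfl, h1, h2⟩ := this
    have : v = [] := by
      clear * - h1 h2 hxy
      cases v with
      | nil => rfl
      | cons a v =>
        by_cases c1 : a = x
        · subst c1; simp [-Bool.decide_or, -decide_not, hxy] at h2
        · simp [-Bool.decide_or, -decide_not, c1] at h1
    simp [-Bool.decide_or, -decide_not, this]
  obtain ⟨v, rfl, h1, h2⟩ := strip (R := y :: (C ++ (E ++ y :: D)))
    (S := x :: (C ++ x :: (E ++ D))) hx.1.1.1 hy.1.1.1 (by simpa [-Bool.decide_or, -decide_not] using H1) (by simpa [-Bool.decide_or, -decide_not] using H2)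
  obtain ⟨v, ⟨rfl, h1, h2⟩ | ⟨rfl, h1, h2⟩⟩ := hne h1 h2
  · obtain ⟨v, rfl, h1, h2⟩ := oney (hxhead hC hx.1.1.2) h1 h2
    left; rw [final h1 h2]; simp
  · obtain ⟨v, rfl, h1, h2⟩ := onex (by simp [-Bool.decide_or, -decide_not, hC]) (hyhead hC hy.1.1.2) h1 h2
    right; rw [final h1 h2]; simp

/-- A word with two distinguished letters, each occurring twice, has only one decomposition
with the first occurrences adjacent. -/
theorem decomposition_unique {x y r s : α} (hxy : x ≠ y) {A C E D A' C' E' D' e e' : List α}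
    (hx : x ∉ A ++ C ++ E ++ D) (hy : y ∉ A ++ C ++ E ++ D)
    (he : e = [x, y] ∨ e = [y, x]) (he' : e' = [r, s] ∨ e' = [s, r])
    (hrs : (r = x ∧ s = y) ∨ (r = y ∧ s = x))
    (h : A ++ e ++ C ++ x :: E ++ y :: D = A' ++ e' ++ C' ++ r :: E' ++ s :: D') :
    r = x ∧ s = y ∧ e' = e ∧ A' = A ∧ C' = C ∧ E' = E ∧ D' = D := by
  simp only [List.mem_append, not_or] at hx hy
  have f0 : ∀ {L : List α}, x ∉ L → y ∉ L → L.filter (fun r => r = x ∨ r = y) = [] := by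
    intro L h1 h2
    rw [List.filter_eq_nil_iff]
    intro a ha hh
    simp only [decide_eq_true_eq] at hh
    rcases hh with rfl | rfl
    exacts [h1 ha, h2 ha]
  have g0 : ∀ {L : List α}, L.filter (fun r => r = x ∨ r = y) = [] → x ∉ L ∧ y ∉ L := by
    intro L hL
    rw [List.filter_eq_nil_iff] at hL
    exact ⟨fun h => by simpa using hL _ h, fun h => by simpa using hL _ h⟩
  -- Restricted to {x, y}, the left side has just four letters. On the right these are used up by
  -- e', r and s, so the other pieces contain neither letter, and the last two letters force r = x
  -- and s = y.
  have hf := congrArg (List.filter (fun r => r = x ∨ r = y)) h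
  have fe : e.filter (fun r => r = x ∨ r = y) = e := by rcases he with rfl | rfl <;> simp
  have fe' : e'.filter (fun r => r = x ∨ r = y) = e' := by
    rcases he' with rfl | rfl <;> rcases hrs with ⟨rfl, rfl⟩ | ⟨rfl, rfl⟩ <;> simp
  have fr : decide (r = x ∨ r = y) = true := by simp; tauto
  have fs : decide (s = x ∨ s = y) = true := by simp; tauto
  simp only [List.filter_append, List.filter_cons, fe, fe', fr, fs, f0 hx.1.1.1 hy.1.1.1,
    f0 hx.1.1.2 hy.1.1.2, f0 hx.1.2 hy.1.2, f0 hx.2 hy.2, if_true] at hf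
  have le : e.length = 2 := by rcases he with rfl | rfl <;> simp
  have le' : e'.length = 2 := by rcases he' with rfl | rfl <;> simp
  have hlen := congrArg List.length hf
  simp [-Bool.decide_or, -decide_not, le, le'] at hlen
  have z1 : A'.filter (fun r => r = x ∨ r = y) = [] :=
    List.eq_nil_of_length_eq_zero (by omega)
  have z2 : C'.filter (fun r => r = x ∨ r = y) = [] :=
    List.eq_nil_of_length_eq_zero (by omega)
  have z3 : E'.filter (fun r => r = x ∨ r = y) = [] :=
    List.eq_nil_of_length_eq_zero (by omega)
  have z4 : D'.filter (fun r => r = x ∨ r = y) = [] :=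
    List.eq_nil_of_length_eq_zero (by omega)
  simp only [z1, z2, z3, z4] at hf
  have hf' : e ++ [x, y] = e' ++ [r, s] := by simpa using hf
  obtain ⟨rfl, h3⟩ := List.append_inj hf' (by omega)
  have hr : x = r := by simpa using (List.cons.inj h3).1
  have hs : y = s := by simpa using (List.cons.inj h3).2
  subst hr hs
  refine ⟨rfl, rfl, rfl, ?_⟩
  have a1 := g0 z1
  have a2 := g0 z2
  have a3 := g0 z3
  have main : A = A' ∧ C ++ x :: E ++ y :: D = C' ++ x :: E' ++ y :: D' := by
    rcases he with rfl | rfl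
    · obtain ⟨h1, h2⟩ := append_cons_unique (p := x) (A := A) (A' := A')
        (B := y :: (C ++ x :: E ++ y :: D)) (B' := y :: (C' ++ x :: E' ++ y :: D'))
        (by simpa [-Bool.decide_or, -decide_not] using h) hx.1.1.1 a1.1
      exact ⟨h1, by simpa [-Bool.decide_or, -decide_not] using h2⟩
    · obtain ⟨h1, h2⟩ := append_cons_unique (p := y) (A := A) (A' := A')
        (B := x :: (C ++ x :: E ++ y :: D)) (B' := x :: (C' ++ x :: E' ++ y :: D'))
        (by simpa [-Bool.decide_or, -decide_not] using h) hy.1.1.1 a1.2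
      exact ⟨h1, by simpa [-Bool.decide_or, -decide_not] using h2⟩
  obtain ⟨h1, h2⟩ := main
  obtain ⟨h3, h4⟩ := append_cons_unique (p := x) (A := C) (A' := C') (B := E ++ y :: D)
    (B' := E' ++ y :: D') (by simpa [-Bool.decide_or, -decide_not] using h2) hx.1.1.2 a2.1
  obtain ⟨h5, h6⟩ := append_cons_unique h4 hy.1.2 a3.2
  exact ⟨h1.symm, h3.symm, h5.symm, h6.symm⟩

end ListLemmas

/-! ### Identities tested by substitutions into factors of a word -/

/-- `u ≈ v` passes, from left to right, all tests by substitutions into factors of `c`. -/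
def FactorEq (c u v : List Letter) : Prop :=
  ∀ φ : Letter → List Letter, u.flatMap φ <:+: c → v.flatMap φ = u.flatMap φ

/-- The status of an occurrence of a letter in a word in which no letter occurs more than
twice: the only one, the first one, or the second one. -/
inductive Kind : Type
  | lin : Kind
  | fst : Kind
  | snd : Kind
  deriving DecidableEq

/-- Every letter of the annotated word `W` belongs to a pair of letters that form the subword
`p ℓ p`. -/
def Paired (W : List (Letter × Kind)) : Prop :=
  ∀ a ∈ W, ∃ p l, p ≠ l ∧ (a.1 = p ∨ a.1 = l) ∧
    W.filter (fun b => b.1 = p ∨ b.1 = l) = [(p, .fst), (l, .lin), (p, .snd)]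

theorem filter_map_fst (A : List (Letter × Kind)) (p l : Letter) :
    (A.map Prod.fst).filter (fun r => r = p ∨ r = l) =
      (A.filter (fun b => b.1 = p ∨ b.1 = l)).map Prod.fst := by
  rw [List.filter_map]; rfl

theorem notMem_of_filter_nil {A : List Letter} {p l : Letter}
    (h : A.filter (fun r => r = p ∨ r = l) = []) : p ∉ A ∧ l ∉ A := by
  rw [List.filter_eq_nil_iff] at h
  exact ⟨fun hh => by simpa using h _ hh, fun hh => by simpa using h _ hh⟩

/-- The given occurrence is one of the three letters of its subword p ℓ p. The number of these
letters to its left, zero, one or two, gives its kind and shows on which side the companion ℓ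
stands. -/
theorem Paired.cases {W A D : List (Letter × Kind)} {p : Letter} {i : Kind} (hW : Paired W)
    (h : W = A ++ (p, i) :: D) :
    (i = .lin ∧ p ∉ A.map Prod.fst ∧ p ∉ D.map Prod.fst) ∨
    (i = .fst ∧ ∃ l, p ≠ l ∧ (A.map Prod.fst).filter (fun r => r = p ∨ r = l) = [] ∧
      (D.map Prod.fst).filter (fun r => r = p ∨ r = l) = [l, p]) ∨
    (i = .snd ∧ ∃ l, p ≠ l ∧ (A.map Prod.fst).filter (fun r => r = p ∨ r = l) = [p, l] ∧
      (D.map Prod.fst).filter (fun r => r = p ∨ r = l) = []) := by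
  obtain ⟨p₀, l₀, hne, hp, hf⟩ := hW (p, i) (by simp [h])
  rw [h, List.filter_append, List.filter_cons] at hf
  rw [if_pos (by simpa using hp)] at hf
  simp only [filter_map_fst]
  rcases hA : A.filter (fun b => b.1 = p₀ ∨ b.1 = l₀) with _ | ⟨a, _ | ⟨b, _ | ⟨c, L⟩⟩⟩
  · rw [hA] at hf
    simp only [List.nil_append, List.cons.injEq, Prod.mk.injEq] at hf
    obtain ⟨⟨rfl, rfl⟩, hD⟩ := hf
    refine Or.inr (Or.inl ⟨rfl, l₀, hne, by rw [hA]; rfl, by rw [hD]; rfl⟩)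
  · rw [hA] at hf
    simp only [List.cons_append, List.nil_append, List.cons.injEq, Prod.mk.injEq] at hf
    obtain ⟨rfl, ⟨rfl, rfl⟩, hD⟩ := hf
    refine Or.inl ⟨rfl, ?_, ?_⟩
    · intro hmem
      have : p ∈ (A.map Prod.fst).filter (fun r => r = p₀ ∨ r = p) := by simp [hmem]
      rw [filter_map_fst, hA] at this
      simp at this
      exact hne this.symm
    · intro hmem
      have : p ∈ (D.map Prod.fst).filter (fun r => r = p₀ ∨ r = p) := by simp [hmem]
      rw [filter_map_fst, hD] at this
      simp at this
      exact hne this.symm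
  · rw [hA] at hf
    simp only [List.cons_append, List.nil_append, List.cons.injEq, Prod.mk.injEq] at hf
    obtain ⟨rfl, rfl, ⟨rfl, rfl⟩, hD⟩ := hf
    refine Or.inr (Or.inr ⟨rfl, l₀, hne, by rw [hA]; rfl, by rw [hD]; rfl⟩)
  · rw [hA] at hf
    simp at hf

/-- The factors of `c` by which the relative order of two occurrences can be tested, unless
both are first or both are second occurrences. -/
structure Detects (c : List Letter) : Prop where
  lin_lin : ∃ p q, p ≠ q ∧ [p, q] <:+: c
  snd_fst : ∃ p q r U U', p ≠ q ∧ r ≠ p ∧ U.filter (fun a => a = p ∨ a = r) = [r] ∧ q ∉ U ∧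
    p ∉ U' ∧ q ∉ U' ∧ p :: U ++ p :: q :: U' ++ [q] <:+: c
  fst_snd : ∃ p q U U', p ≠ q ∧ p ∉ U ∧ q ∉ U ∧ p ∉ U' ∧ q ∉ U' ∧
    q :: U ++ p :: q :: U' ++ [p] <:+: c

theorem filter_nil_of_notMem {A : List Letter} {p l : Letter} (h1 : p ∉ A) (h2 : l ∉ A) :
    A.filter (fun r => r = p ∨ r = l) = [] := by
  rw [List.filter_eq_nil_iff]
  intro a ha hh
  simp only [decide_eq_true_eq] at hh
  rcases hh with rfl | rfl
  exacts [h1 ha, h2 ha]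

theorem flatMap_of_filter {A L : List Letter} {φ : Letter → List Letter} {p l : Letter}
    (h : A.filter (fun r => r = p ∨ r = l) = L) (h0 : ∀ r ∈ A, r ≠ p → r ≠ l → φ r = []) :
    A.flatMap φ = L.flatMap φ := by
  rw [← h]
  exact flatMap_eq_filter_flatMap fun r hr hh => by
    simp only [not_or] at hh
    exact h0 r hr hh.1 hh.2

/-- For a letter of W, delete everything but its pair p, ℓ and map p ℓ p onto the factor p U p of c;
the markers then give the restriction of v to {p, ℓ}. For a letter outside W, delete all the others:
the image of W is empty, so that of v is empty too. -/
theorem FactorEq.perm {c v : List Letter} {W : List (Letter × Kind)} (hc : Detects c)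
    (hW : Paired W) (h : FactorEq c (W.map Prod.fst) v) : v.Perm (W.map Prod.fst) := by
  rw [List.perm_iff_count]
  intro a
  by_cases ha : a ∈ W.map Prod.fst
  · obtain ⟨b, hb, rfl⟩ := List.mem_map.mp ha
    obtain ⟨p, l, hne, hpl, hf⟩ := hW b hb
    obtain ⟨a', q, r, U, U', -, hrx, hU, -, -, -, hin⟩ := hc.snd_fst
    have hu : (W.map Prod.fst).filter (fun r => r = p ∨ r = l) = [p, l, p] := by
      rw [filter_map_fst, hf]; rfl
    have key := filter_eq_of_flatMap_eq (p := p) (q := l) (p' := a') (q' := r)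
      (φ := fun s => if s = p then [a'] else if s = l then U else [])
      hrx.symm (by simp) (by simpa [-Bool.decide_or, hne.symm] using hU)
      (by intro s h1 h2; simp [h1, h2]) (h _ (by
        rw [flatMap_of_filter hu (by intro s _ h1 h2; simp [h1, h2])]
        simp only [List.flatMap_cons, List.flatMap_nil, if_true, hne.symm, if_false]
        exact IsInfix.trans ⟨[], q :: U' ++ [q], by simp⟩ hin))
    have hb : decide (b.1 = p ∨ b.1 = l) = true := by simpa using hpl
    rw [← List.count_filter (p := fun r => decide (r = p ∨ r = l)) (l := v) hb,
      ← List.count_filter (p := fun r => decide (r = p ∨ r = l)) (l := W.map Prod.fst) hb, key]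
  · have h1 : (W.map Prod.fst).flatMap (fun s => if s = a then [s] else []) = [] := by
      rw [List.flatMap_eq_nil_iff]
      intro s hs
      rw [if_neg]
      rintro rfl
      exact ha hs
    have h2 := h (fun s => if s = a then [s] else []) (by rw [h1]; exact List.nil_infix)
    rw [h1, List.flatMap_eq_nil_iff] at h2
    have : a ∉ v := fun hv => by simpa using h2 a hv
    rw [List.count_eq_zero_of_not_mem this, List.count_eq_zero_of_not_mem ha]

/-- The repeated p in the disjunction lets `flatMap_of_filter`, which is stated for two letters,
keep a single one. -/
theorem filter_self_of_filter {A L : List Letter} {p l : Letter}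
    (h : A.filter (fun r => r = p ∨ r = l) = L) :
    A.filter (fun r => r = p ∨ r = p) = L.filter (fun r => r = p ∨ r = p) := by
  rw [← h, List.filter_filter]
  apply List.filter_congr
  intro a _
  by_cases ha : a = p <;> simp [ha]

/-- The substitution keeps p, q and, where needed, their linear companions; all other letters are
deleted. A companion lies between the two occurrences of its letter, so it can be mapped to the
inner part U or U' of a factor from `Detects`. Of the nine combinations of kinds two are excluded;
linear–linear uses `lin_lin`, first–second uses `fst_snd`, and the other five use parts of the
factor in `snd_fst`. -/
theorem FactorEq.filter_eq_of_adjacent {c v : List Letter} {W A D : List (Letter × Kind)}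
    {p q : Letter} {i j : Kind} (hc : Detects c) (hW : Paired W)
    (h : FactorEq c (W.map Prod.fst) v) (hs : W = A ++ (p, i) :: (q, j) :: D)
    (hff : ¬ (i = .fst ∧ j = .fst)) (hss : ¬ (i = .snd ∧ j = .snd)) :
    v.filter (fun r => r = p ∨ r = q) = (W.map Prod.fst).filter (fun r => r = p ∨ r = q) := by
  have e1 := hW.cases hs
  have e2 := hW.cases (A := A ++ [(p, i)]) (p := q) (i := j) (D := D) (by simp [hs])
  have hu : W.map Prod.fst = A.map Prod.fst ++ p :: q :: D.map Prod.fst := by simp [hs]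
  clear hs hW
  rw [hu] at h ⊢
  simp only [List.map_append, List.map_cons, List.map_nil] at e1 e2
  generalize A.map Prod.fst = A at *
  generalize D.map Prod.fst = D at *
  clear hu W
  rcases e1 with ⟨rfl, hA, hD⟩ | ⟨rfl, l, hl, hA, hD⟩ | ⟨rfl, l, hl, hA, hD⟩ <;>
    rcases e2 with ⟨rfl, hA', hD'⟩ | ⟨rfl, l', hl', hA', hD'⟩ | ⟨rfl, l', hl', hA', hD'⟩
  · obtain ⟨a, b, hab, hin⟩ := hc.lin_lin
    simp only [List.mem_cons, not_or] at hD
    simp only [List.mem_append, List.mem_singleton, not_or] at hA'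
    refine filter_eq_of_flatMap_eq (p' := a) (q' := b)
      (φ := fun s => if s = p then [a] else if s = q then [b] else [])
      hab (by simp) (by simp [Ne.symm hD.1]) (by intro s h1 h2; simp [h1, h2]) (h _ ?_)
    rw [List.flatMap_append, List.flatMap_cons, List.flatMap_cons,
      flatMap_of_filter (filter_nil_of_notMem hA hA'.1) (by intro s _ h1 h2; simp [h1, h2]),
      flatMap_of_filter (filter_nil_of_notMem hD.2 hD') (by intro s _ h1 h2; simp [h1, h2])]
    simpa [Ne.symm hD.1] using hin
  · obtain ⟨a, b, r, U, U', hab, hr, hUf, hbU, haU', hbU', hin⟩ := hc.snd_fst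
    simp only [List.mem_cons, not_or] at hD
    have hn := notMem_of_filter_nil hA'
    simp only [List.mem_append, List.mem_singleton, not_or] at hn
    refine filter_eq_of_flatMap_eq (p' := a) (q' := b)
      (φ := fun s => if s = p then [a] else if s = q then [b] else if s = l' then U' else [])
      hab (by simp) (by simp [Ne.symm hD.1])
      (by intro s h1 h2; simp only [h1, h2, if_false]; split_ifs
          · exact filter_nil_of_notMem haU' hbU'
          · rfl) (h _ ?_)
    rw [List.flatMap_append, List.flatMap_cons, List.flatMap_cons,
      flatMap_of_filter (filter_nil_of_notMem hn.1.1 hn.2.1) (by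
        intro s hs h1 h2
        have : s ≠ p := fun e => hA (e ▸ hs)
        simp [h1, h2, this]),
      flatMap_of_filter hD' (by
        intro s hs h1 h2
        have : s ≠ p := fun e => hD.2 (e ▸ hs)
        simp [h1, h2, this])]
    refine IsInfix.trans ?_ hin
    exact ⟨a :: U, [], by simp [Ne.symm hD.1, Ne.symm hl', hn.2.2]⟩
  · obtain ⟨a, b, r, U, U', hab, hr, hUf, hbU, haU', hbU', hin⟩ := hc.snd_fst
    simp only [List.mem_cons, not_or] at hD
    have hqD := (notMem_of_filter_nil hD').1
    have hAq := filter_self_of_filter hA'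
    rw [List.filter_append] at hAq
    simp [-Bool.decide_or, hD.1, hl'.symm] at hAq
    refine filter_eq_of_flatMap_eq (p' := r) (q' := a)
      (φ := fun s => if s = p then U else if s = q then [a] else [])
      hr (by simpa [-Bool.decide_or, or_comm] using hUf)
      (by simp [Ne.symm hD.1, -Bool.decide_or]) (by intro s h1 h2; simp [h1, h2]) (h _ ?_)
    rw [List.flatMap_append, List.flatMap_cons, List.flatMap_cons,
      flatMap_of_filter (A := A) (p := q) (l := q) (L := [q]) (by simpa using hAq) (by
        intro s hs h1 h2
        have : s ≠ p := fun e => hA (e ▸ hs)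
        simp [h1, this]),
      flatMap_of_filter (filter_nil_of_notMem hqD hD.2) (by intro s _ h1 h2; simp [h1, h2])]
    refine IsInfix.trans ?_ hin
    exact ⟨[], b :: U' ++ [b], by simp [Ne.symm hD.1]⟩
  · obtain ⟨a, b, r, U, U', hab, hr, hUf, hbU, haU', hbU', hin⟩ := hc.snd_fst
    simp only [List.mem_append, List.mem_singleton, not_or] at hA'
    have hpA := (notMem_of_filter_nil hA).1
    have hDp := filter_self_of_filter hD
    simp [-Bool.decide_or, hA'.2, hl.symm] at hDp
    refine filter_eq_of_flatMap_eq (p' := a) (q' := r)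
      (φ := fun s => if s = p then [a] else if s = q then U else [])
      hr.symm (by simp) (by simpa [hA'.2, -Bool.decide_or] using hUf)
      (by intro s h1 h2; simp [h1, h2]) (h _ ?_)
    rw [List.flatMap_append, List.flatMap_cons, List.flatMap_cons,
      flatMap_of_filter (filter_nil_of_notMem hpA hA'.1) (by intro s _ h1 h2; simp [h1, h2]),
      flatMap_of_filter (A := D) (p := p) (l := p) (L := [p]) (by simpa using hDp) (by
        intro s hs h1 h2
        have : s ≠ q := fun e => hD' (e ▸ hs)
        simp [h1, this])]
    refine IsInfix.trans ?_ hin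
    exact ⟨[], b :: U' ++ [b], by simp [hA'.2]⟩
  · exact absurd ⟨rfl, rfl⟩ hff
  · obtain ⟨a, b, U, U', hab, haU, hbU, haU', hbU', hin⟩ := hc.fst_snd
    have hnA := notMem_of_filter_nil hA
    have hnD := notMem_of_filter_nil hD'
    have hpq : p ≠ q := by
      rintro rfl
      simp [-Bool.decide_or] at hD
      exact hl hD.1
    have hqA : q ∈ A := by
      have : q ∈ (A ++ [p]).filter (fun r => r = q ∨ r = l') := by rw [hA']; simp
      simpa [hpq.symm] using (List.mem_filter.mp this).1
    have hql : q ≠ l := fun e => hnA.2 (e ▸ hqA)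
    rw [List.filter_cons_of_neg (by simp [hpq.symm, hql])] at hD
    have hmD : ∀ s, s = l ∨ s = p → s ∈ D := by
      intro s hs
      have : s ∈ D.filter (fun r => r = p ∨ r = l) := by rw [hD]; simpa using hs
      exact (List.mem_filter.mp this).1
    have hpl' : p ≠ l' := fun e => hnD.2 (e ▸ hmD p (Or.inr rfl))
    have hll' : l ≠ l' := fun e => hnD.2 (e ▸ hmD l (Or.inl rfl))
    rw [List.filter_append] at hA'
    simp [-Bool.decide_or, hpq, hpl'] at hA'
    refine filter_eq_of_flatMap_eq (p' := a) (q' := b)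
      (φ := fun s => if s = p then [a] else if s = q then [b] else if s = l' then U else
        if s = l then U' else [])
      hab (by simp) (by simp [hpq.symm])
      (by intro s h1 h2; simp only [h1, h2, if_false]; split_ifs
          · exact filter_nil_of_notMem haU hbU
          · exact filter_nil_of_notMem haU' hbU'
          · rfl) (h _ ?_)
    rw [List.flatMap_append, List.flatMap_cons, List.flatMap_cons,
      flatMap_of_filter hA' (by
        intro s hs h1 h2
        have h3 : s ≠ p := fun e => hnA.1 (e ▸ hs)
        have h4 : s ≠ l := fun e => hnA.2 (e ▸ hs)
        simp [h1, h2, h3, h4]),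
      flatMap_of_filter hD (by
        intro s hs h1 h2
        have h3 : s ≠ q := fun e => hnD.1 (e ▸ hs)
        have h4 : s ≠ l' := fun e => hnD.2 (e ▸ hs)
        simp [h1, h2, h3, h4])]
    simpa [hpq.symm, hl.symm, hl'.symm, hpl'.symm, hll', hll'.symm, hql.symm] using hin
  · obtain ⟨a, b, r, U, U', hab, hr, hUf, hbU, haU', hbU', hin⟩ := hc.snd_fst
    simp only [List.mem_append, List.mem_singleton, not_or] at hA'
    have hn := notMem_of_filter_nil hD
    simp only [List.mem_cons, not_or] at hn
    have haU : a ∉ U := by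
      intro ha
      have : a ∈ U.filter (fun s => s = a ∨ s = r) := by simp [ha]
      rw [hUf] at this
      simp at this
      exact hr this.symm
    refine filter_eq_of_flatMap_eq (p' := a) (q' := b)
      (φ := fun s => if s = p then [a] else if s = q then [b] else if s = l then U else [])
      hab (by simp) (by simp [hA'.2])
      (by intro s h1 h2; simp only [h1, h2, if_false]; split_ifs
          · exact filter_nil_of_notMem haU hbU
          · rfl) (h _ ?_)
    rw [List.flatMap_append, List.flatMap_cons, List.flatMap_cons,
      flatMap_of_filter hA (by
        intro s hs h1 h2
        have h3 : s ≠ q := fun e => hA'.1 (e ▸ hs)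
        simp [h1, h2, h3]),
      flatMap_of_filter (filter_nil_of_notMem hn.1.2 hD') (by
        intro s hs h1 h2
        have h3 : s ≠ l := fun e => hn.2.2 (e ▸ hs)
        simp [h1, h2, h3])]
    refine IsInfix.trans ?_ hin
    exact ⟨[], U' ++ [b], by simp [hA'.2, hl.symm, hn.2.1]⟩
  · obtain ⟨a, b, r, U, U', hab, hr, hUf, hbU, haU', hbU', hin⟩ := hc.snd_fst
    have hnA := notMem_of_filter_nil hA'
    have hnD := notMem_of_filter_nil hD
    simp only [List.mem_append, List.mem_singleton, List.mem_cons, not_or] at hnA hnD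
    have hlA : l ∈ A := by
      have : l ∈ A.filter (fun r => r = p ∨ r = l) := by rw [hA]; simp
      exact (List.mem_filter.mp this).1
    have hll' : l ≠ l' := fun e => hnA.2.1 (e ▸ hlA)
    have haU : a ∉ U := by
      intro ha
      have : a ∈ U.filter (fun s => s = a ∨ s = r) := by simp [ha]
      rw [hUf] at this
      simp at this
      exact hr this.symm
    refine filter_eq_of_flatMap_eq (p' := a) (q' := b)
      (φ := fun s => if s = p then [a] else if s = q then [b] else if s = l then U else
        if s = l' then U' else [])
      hab (by simp) (by simp [hnA.1.2])
      (by intro s h1 h2; simp only [h1, h2, if_false]; split_ifs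
          · exact filter_nil_of_notMem haU hbU
          · exact filter_nil_of_notMem haU' hbU'
          · rfl) (h _ ?_)
    rw [List.flatMap_append, List.flatMap_cons, List.flatMap_cons,
      flatMap_of_filter hA (by
        intro s hs h1 h2
        have h3 : s ≠ q := fun e => hnA.1.1 (e ▸ hs)
        have h4 : s ≠ l' := fun e => hnA.2.1 (e ▸ hs)
        simp [h1, h2, h3, h4]),
      flatMap_of_filter hD' (by
        intro s hs h1 h2
        have h3 : s ≠ p := fun e => hnD.1.2 (e ▸ hs)
        have h4 : s ≠ l := fun e => hnD.2.2 (e ▸ hs)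
        simp [h1, h2, h3, h4])]
    simpa [hnA.1.2, hl.symm, hl'.symm, hll', hll'.symm, hnA.2.2.1, hnD.2.1] using hin
  · exact absurd ⟨rfl, rfl⟩ hss

/-- A word without adjacent first occurrences and without adjacent second occurrences is
determined by the tests. -/
theorem FactorEq.eq {c v : List Letter} {W : List (Letter × Kind)} (hc : Detects c)
    (hW : Paired W) (h : FactorEq c (W.map Prod.fst) v)
    (hff : ∀ A p q D, W ≠ A ++ (p, .fst) :: (q, .fst) :: D)
    (hss : ∀ A p q D, W ≠ A ++ (p, .snd) :: (q, .snd) :: D) : v = W.map Prod.fst := by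
  refine eq_of_filter_adjacent (h.perm hc hW) ?_
  intro A p q D hs
  obtain ⟨A', R, rfl, rfl, hR⟩ := List.map_eq_append_iff.mp hs
  obtain ⟨⟨p, i⟩, R', rfl, rfl, hR'⟩ := List.map_eq_cons_iff.mp hR
  obtain ⟨⟨q, j⟩, R, rfl, rfl, rfl⟩ := List.map_eq_cons_iff.mp hR'
  refine h.filter_eq_of_adjacent hc hW rfl ?_ ?_
  · rintro ⟨rfl, rfl⟩; exact hff _ _ _ _ rfl
  · rintro ⟨rfl, rfl⟩; exact hss _ _ _ _ rfl

/-! ### The annotated test word and its linear companions -/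

/-- The annotated word `z_a t_a … z_{a+k-1} t_{a+k-1}` of first occurrences. -/
def preA (a k : ℕ) : List (Letter × Kind) :=
  (List.range' a k).flatMap fun i => [(.z i, .fst), (.s i, .lin)]

/-- The annotated word `t_a z_a … t_{a+k-1} z_{a+k-1}` of second occurrences. -/
def postA (a k : ℕ) : List (Letter × Kind) :=
  (List.range' a k).flatMap fun i => [(.s i, .lin), (.z i, .snd)]

/-- The annotated word `z_{o+0ρ} z_{o+1ρ} …`, in which the letters with `iρ < p` occur for the
second time and the others for the first time. -/
def midA (p o : ℕ) {N : ℕ} (ρ : Equiv.Perm (Fin N)) : List (Letter × Kind) :=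
  List.ofFn fun i => (.z (o + ρ i), if (ρ i : ℕ) < p then .snd else .fst)

theorem mem_preA {a k : ℕ} {b : Letter × Kind} :
    b ∈ preA a k ↔ ∃ i, (a ≤ i ∧ i < a + k) ∧ (b = (.z i, .fst) ∨ b = (.s i, .lin)) := by
  simp [preA, List.mem_range'_1]

theorem mem_postA {a k : ℕ} {b : Letter × Kind} :
    b ∈ postA a k ↔ ∃ i, (a ≤ i ∧ i < a + k) ∧ (b = (.s i, .lin) ∨ b = (.z i, .snd)) := by
  simp [postA, List.mem_range'_1]

theorem mem_midA {p o N : ℕ} {ρ : Equiv.Perm (Fin N)} {b : Letter × Kind} :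
    b ∈ midA p o ρ ↔ ∃ i, i < N ∧ b = (.z (o + i), if i < p then .snd else .fst) := by
  simp only [midA, List.mem_ofFn]
  constructor
  · rintro ⟨i, rfl⟩
    exact ⟨ρ i, (ρ i).2, rfl⟩
  · rintro ⟨i, hi, rfl⟩
    exact ⟨ρ.symm ⟨i, hi⟩, by simp⟩

theorem filter_preA (a k j : ℕ) :
    (preA a k).filter (fun b => b.1 = .z j ∨ b.1 = .s j) =
      if a ≤ j ∧ j < a + k then [(.z j, .fst), (.s j, .lin)] else [] := by
  induction k generalizing a with
  | zero => simp [preA]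
  | succ k ih =>
    have : preA a (k + 1) = (.z a, .fst) :: (.s a, .lin) :: preA (a + 1) k := by
      simp [preA, List.range'_succ]
    rw [this]
    by_cases h : a = j
    · subst h
      simp [-Bool.decide_or, ih]
    · rw [List.filter_cons_of_neg (by simpa using h), List.filter_cons_of_neg (by simpa using h), ih]
      split_ifs <;> first | rfl | omega

theorem filter_postA (a k j : ℕ) :
    (postA a k).filter (fun b => b.1 = .z j ∨ b.1 = .s j) =
      if a ≤ j ∧ j < a + k then [(.s j, .lin), (.z j, .snd)] else [] := by
  induction k generalizing a with
  | zero => simp [postA]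
  | succ k ih =>
    have : postA a (k + 1) = (.s a, .lin) :: (.z a, .snd) :: postA (a + 1) k := by
      simp [postA, List.range'_succ]
    rw [this]
    by_cases h : a = j
    · subst h
      simp [-Bool.decide_or, ih]
    · rw [List.filter_cons_of_neg (by simpa using h), List.filter_cons_of_neg (by simpa using h), ih]
      split_ifs <;> first | rfl | omega

theorem nodup_midA (p o : ℕ) {N : ℕ} (ρ : Equiv.Perm (Fin N)) : (midA p o ρ).Nodup := by
  rw [midA, List.nodup_ofFn]
  intro i j h
  simp only [Prod.mk.injEq, Letter.z.injEq] at h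
  exact ρ.injective (Fin.ext (by omega))

theorem filter_midA (p o j : ℕ) {N : ℕ} (ρ : Equiv.Perm (Fin N)) :
    (midA p o ρ).filter (fun b => b.1 = .z j ∨ b.1 = .s j) =
      if o ≤ j ∧ j < o + N then [(.z j, if j - o < p then .snd else .fst)] else [] := by
  split_ifs with h h'
  · have hm : (Letter.z j, Kind.snd) ∈ midA p o ρ := mem_midA.mpr
      ⟨j - o, by omega, by simp [h', show o + (j - o) = j by omega]⟩
    rw [List.filter_congr (q := fun b => b == (Letter.z j, Kind.snd)), List.filter_beq,
      List.count_eq_one_of_mem (nodup_midA p o ρ) hm]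
    · rfl
    · intro b hb
      obtain ⟨i, hi, rfl⟩ := mem_midA.mp hb
      by_cases hij : o + i = j
      · have : i < p := by omega
        simp [hij, this]
      · simp [hij]
  · have hm : (Letter.z j, Kind.fst) ∈ midA p o ρ := mem_midA.mpr
      ⟨j - o, by omega, by simp [h', show o + (j - o) = j by omega]⟩
    rw [List.filter_congr (q := fun b => b == (Letter.z j, Kind.fst)), List.filter_beq,
      List.count_eq_one_of_mem (nodup_midA p o ρ) hm]
    · rfl
    · intro b hb
      obtain ⟨i, hi, rfl⟩ := mem_midA.mp hb
      by_cases hij : o + i = j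
      · have : ¬ i < p := by omega
        simp [hij, this]
      · simp [hij]
  · rw [List.filter_eq_nil_iff]
    intro b hb
    obtain ⟨i, hi, rfl⟩ := mem_midA.mp hb
    simp
    omega

/-- The lists at the five places of the letters `x` and `y`: `e` at the place of the first
occurrences, `lx` and `ly` at the places of the second ones. Either both letters are present, in
one of the two orders, or one of them has been deleted. -/
def IsSpot (x y : Letter) (e lx ly : List Letter) : Prop :=
  (e = [x, y] ∧ lx = [x] ∧ ly = [y]) ∨ (e = [y, x] ∧ lx = [x] ∧ ly = [y]) ∨
    (e = [x] ∧ lx = [x] ∧ ly = []) ∨ (e = [y] ∧ lx = [] ∧ ly = [y])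

/-- The annotated test word, with the places of the letters `x`, `y` and of their analogues
`z_{2N+5}`, `z_{2N+6}` in the second copy left open. -/
def wordA (n m : ℕ) {N : ℕ} (ρ : Equiv.Perm (Fin N)) (e lx ly d lz lw : List Letter) :
    List (Letter × Kind) :=
  preA 0 n ++ (preA (N + N) 1 ++ (preA N n ++ (e.map (·, .fst) ++ ([(.t, .lin)] ++ (preA n m ++
  (lx.map (·, .snd) ++ (d.map (·, .fst) ++ ([(.z (N + N), .snd)] ++ (midA (n + m) 0 ρ ++ (ly.map
  (·, .snd) ++ (postA (n + m) (n + m + 1) ++ ([(.s (N + N + 5), .lin)] ++ (preA (N + n) m ++ (preA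
  (N + N + 1) 2 ++ (lz.map (·, .snd) ++ ([(.z (N + N + 3), .fst)] ++ ([(.z (N + N + 1), .snd)] ++
  ([(.z (N + N + 4), .fst)] ++ ([(.z (N + N + 2), .snd)] ++ (midA (n + m) N ρ ++ (lw.map (·, .snd)
  ++ (postA (N + n + m) (n + m + 1) ++ postA (N + N + 3) 2))))))))))))))))))))))

theorem filter_single_z (i j : ℕ) (κ : Kind) :
    [((.z i, κ) : Letter × Kind)].filter (fun b => b.1 = .z j ∨ b.1 = .s j) =
      if i = j then [(.z j, κ)] else [] := by
  by_cases h : i = j <;> simp [h]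

theorem filter_single_s (i j : ℕ) (κ : Kind) :
    [((.s i, κ) : Letter × Kind)].filter (fun b => b.1 = .z j ∨ b.1 = .s j) =
      if i = j then [(.s j, κ)] else [] := by
  by_cases h : i = j <;> simp [h]

theorem filter_single_t (j : ℕ) (κ : Kind) :
    [((.t, κ) : Letter × Kind)].filter (fun b => b.1 = .z j ∨ b.1 = .s j) = [] := by
  simp

theorem filter_map_pair {l : List Letter} {κ : Kind} {p q : Letter}
    (h : ∀ r ∈ l, r ≠ p ∧ r ≠ q) :
    (l.map (·, κ)).filter (fun b => b.1 = p ∨ b.1 = q) = [] := by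
  rw [List.filter_eq_nil_iff]
  intro b hb
  obtain ⟨r, hr, rfl⟩ := List.mem_map.mp hb
  simpa using h r hr

theorem IsSpot.mem {x y : Letter} {e lx ly : List Letter} (h : IsSpot x y e lx ly) :
    ∀ r, r ∈ e ∨ r ∈ lx ∨ r ∈ ly → r = x ∨ r = y := by
  rcases h with ⟨rfl, rfl, rfl⟩ | ⟨rfl, rfl, rfl⟩ | ⟨rfl, rfl, rfl⟩ | ⟨rfl, rfl, rfl⟩ <;>
    simp <;> tauto

section
variable {n m N : ℕ} {ρ : Equiv.Perm (Fin N)} {e lx ly d lz lw : List Letter}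

set_option maxHeartbeats 2000000 in
theorem filter_wordA_idx (hN : N = n + m + (n + m + 1)) (he : IsSpot .x .y e lx ly)
    (hd : IsSpot (.z (N + N + 5)) (.z (N + N + 6)) d lz lw) {j : ℕ} (hj : j < N + N + 5) :
    (wordA n m ρ e lx ly d lz lw).filter (fun b => b.1 = .z j ∨ b.1 = .s j) =
      [(.z j, .fst), (.s j, .lin), (.z j, .snd)] := by
  have h1 : ∀ r, r ∈ e ∨ r ∈ lx ∨ r ∈ ly → r ≠ .z j ∧ r ≠ .s j := by
    intro r hr
    rcases he.mem r hr with rfl | rfl <;> simp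
  have h2 : ∀ r, r ∈ d ∨ r ∈ lz ∨ r ∈ lw → r ≠ .z j ∧ r ≠ .s j := by
    intro r hr
    rcases hd.mem r hr with rfl | rfl <;> simp <;> omega
  simp only [wordA, List.filter_append, filter_single_z, filter_single_s, filter_single_t, filter_preA, filter_postA, filter_midA,
    filter_map_pair (fun r hr => h1 r (Or.inl hr)),
    filter_map_pair (fun r hr => h1 r (Or.inr (Or.inl hr))),
    filter_map_pair (fun r hr => h1 r (Or.inr (Or.inr hr))),
    filter_map_pair (fun r hr => h2 r (Or.inl hr)),
    filter_map_pair (fun r hr => h2 r (Or.inr (Or.inl hr))),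
    filter_map_pair (fun r hr => h2 r (Or.inr (Or.inr hr))), List.nil_append]
  -- The ranges are the index sets of the three kinds of letters in each copy of c, followed by the
  -- five additional letters. In each of them exactly two pieces of the word contribute, in the
  -- right order.
  have hcases : j < n ∨ (n ≤ j ∧ j < n + m) ∨ (n + m ≤ j ∧ j < N) ∨ (N ≤ j ∧ j < N + n) ∨
    (N + n ≤ j ∧ j < N + n + m) ∨ (N + n + m ≤ j ∧ j < N + N) ∨ j = N + N ∨ j = N + N + 1 ∨
    j = N + N + 2 ∨ j = N + N + 3 ∨ j = N + N + 4 := by omega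
  rcases hcases with h | h | h | h | h | h | h | h | h | h | h <;>
    simp (disch := omega) only [if_pos, if_neg, List.nil_append, List.cons_append, List.append_nil]

theorem filter_wordA_x (he : IsSpot .x .y e lx ly)
    (hd : IsSpot (.z (N + N + 5)) (.z (N + N + 6)) d lz lw) {p : Letter}
    (hp : p = .x ∨ p = .y) :
    (wordA n m ρ e lx ly d lz lw).filter (fun b => b.1 = p ∨ b.1 = .t) =
      ((e.filter (fun r => r = p)).map (·, .fst)) ++ (.t, .lin) ::
        ((lx ++ ly).filter (fun r => r = p)).map (·, .snd) := by
  have nil : ∀ {L : List (Letter × Kind)}, (∀ b ∈ L, b.1 ≠ p ∧ b.1 ≠ .t) →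
      L.filter (fun b => b.1 = p ∨ b.1 = .t) = [] := by
    intro L hL
    rw [List.filter_eq_nil_iff]
    intro b hb
    simpa using hL b hb
  have hpre : ∀ a k, (preA a k).filter (fun b => b.1 = p ∨ b.1 = .t) = [] := by
    intro a k
    refine nil fun b hb => ?_
    obtain ⟨i, -, rfl | rfl⟩ := mem_preA.mp hb <;> rcases hp with rfl | rfl <;> simp
  have hpost : ∀ a k, (postA a k).filter (fun b => b.1 = p ∨ b.1 = .t) = [] := by
    intro a k
    refine nil fun b hb => ?_
    obtain ⟨i, -, rfl | rfl⟩ := mem_postA.mp hb <;> rcases hp with rfl | rfl <;> simp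
  have hmid : ∀ a, (midA (n + m) a ρ).filter (fun b => b.1 = p ∨ b.1 = .t) = [] := by
    intro a
    refine nil fun b hb => ?_
    obtain ⟨i, -, rfl⟩ := mem_midA.mp hb
    rcases hp with rfl | rfl <;> simp
  have hz : ∀ (l : List Letter) (κ : Kind), (∀ r ∈ l, r ∈ d ∨ r ∈ lz ∨ r ∈ lw) →
      (l.map (·, κ)).filter (fun b => b.1 = p ∨ b.1 = .t) = [] := by
    intro l κ hl
    refine filter_map_pair fun r hr => ?_
    rcases hd.mem r (hl r hr) with rfl | rfl <;> rcases hp with rfl | rfl <;> simp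
  have hx : ∀ (l : List Letter) (κ : Kind), (∀ r ∈ l, r ∈ e ∨ r ∈ lx ∨ r ∈ ly) →
      (l.map (·, κ)).filter (fun b => b.1 = p ∨ b.1 = .t) =
        (l.filter (fun r => r = p)).map (·, κ) := by
    intro l κ hl
    rw [List.filter_map]
    congr 1
    refine List.filter_congr fun r hr => ?_
    rcases he.mem r (hl r hr) with rfl | rfl <;> simp
  have hzp : ∀ i, ¬ (Letter.z i = p ∨ Letter.z i = .t) := by
    intro i; rcases hp with rfl | rfl <;> simp
  have hsp : ∀ i, ¬ (Letter.s i = p ∨ Letter.s i = .t) := by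
    intro i; rcases hp with rfl | rfl <;> simp
  simp only [wordA, List.filter_append, List.filter_cons, List.filter_nil, hpre, hpost, hmid,
    hz d _ (by tauto), hz lz _ (by tauto), hz lw _ (by tauto), hx e _ (by tauto),
    hx lx _ (by tauto), hx ly _ (by tauto), List.nil_append, List.cons_append, decide_eq_true_eq, hzp, hsp,
    if_false, or_true, if_true, List.map_append, List.append_nil]

theorem filter_wordA_zz (he : IsSpot .x .y e lx ly)
    (hd : IsSpot (.z (N + N + 5)) (.z (N + N + 6)) d lz lw) (hN : N = n + m + (n + m + 1))
    {p : Letter} (hp : p = .z (N + N + 5) ∨ p = .z (N + N + 6)) :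
    (wordA n m ρ e lx ly d lz lw).filter (fun b => b.1 = p ∨ b.1 = .s (N + N + 5)) =
      ((d.filter (fun r => r = p)).map (·, .fst)) ++ (.s (N + N + 5), .lin) ::
        ((lz ++ lw).filter (fun r => r = p)).map (·, .snd) := by
  have nil : ∀ {L : List (Letter × Kind)}, (∀ b ∈ L, b.1 ≠ p ∧ b.1 ≠ .s (N + N + 5)) →
      L.filter (fun b => b.1 = p ∨ b.1 = .s (N + N + 5)) = [] := by
    intro L hL
    rw [List.filter_eq_nil_iff]
    intro b hb
    simpa using hL b hb
  have hpre : ∀ a k, a + k ≤ N + N + 5 →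
      (preA a k).filter (fun b => b.1 = p ∨ b.1 = .s (N + N + 5)) = [] := by
    intro a k hk
    refine nil fun b hb => ?_
    obtain ⟨i, hi, rfl | rfl⟩ := mem_preA.mp hb <;> rcases hp with rfl | rfl <;> simp <;> omega
  have hpost : ∀ a k, a + k ≤ N + N + 5 →
      (postA a k).filter (fun b => b.1 = p ∨ b.1 = .s (N + N + 5)) = [] := by
    intro a k hk
    refine nil fun b hb => ?_
    obtain ⟨i, hi, rfl | rfl⟩ := mem_postA.mp hb <;> rcases hp with rfl | rfl <;> simp <;> omega
  have hmid : ∀ a, a ≤ N →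
      (midA (n + m) a ρ).filter (fun b => b.1 = p ∨ b.1 = .s (N + N + 5)) = [] := by
    intro a ha
    refine nil fun b hb => ?_
    obtain ⟨i, hi, rfl⟩ := mem_midA.mp hb
    rcases hp with rfl | rfl <;> simp <;> omega
  have hx : ∀ (l : List Letter) (κ : Kind), (∀ r ∈ l, r ∈ e ∨ r ∈ lx ∨ r ∈ ly) →
      (l.map (·, κ)).filter (fun b => b.1 = p ∨ b.1 = .s (N + N + 5)) = [] := by
    intro l κ hl
    refine filter_map_pair fun r hr => ?_
    rcases he.mem r (hl r hr) with rfl | rfl <;> rcases hp with rfl | rfl <;> simp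
  have hz : ∀ (l : List Letter) (κ : Kind), (∀ r ∈ l, r ∈ d ∨ r ∈ lz ∨ r ∈ lw) →
      (l.map (·, κ)).filter (fun b => b.1 = p ∨ b.1 = .s (N + N + 5)) =
        (l.filter (fun r => r = p)).map (·, κ) := by
    intro l κ hl
    rw [List.filter_map]
    congr 1
    refine List.filter_congr fun r hr => ?_
    rcases hd.mem r (hl r hr) with rfl | rfl <;> simp
  have hzp : ∀ i, i < N + N + 5 → ¬ (Letter.z i = p ∨ Letter.z i = .s (N + N + 5)) := by
    intro i hi; rcases hp with rfl | rfl <;> simp <;> omega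
  have htp : ¬ (Letter.t = p ∨ Letter.t = .s (N + N + 5)) := by
    rcases hp with rfl | rfl <;> simp
  simp only [wordA, List.filter_append, List.filter_cons, List.filter_nil,
    hpre 0 n (by omega), hpre (N + N) 1 (by omega), hpre N n (by omega), hpre n m (by omega),
    hpre (N + n) m (by omega), hpre (N + N + 1) 2 (by omega), hpost (n + m) (n + m + 1) (by omega),
    hpost (N + n + m) (n + m + 1) (by omega), hpost (N + N + 3) 2 (by omega), hmid 0 (by omega),
    hmid N le_rfl, htp, hzp (N + N) (by omega), hzp (N + N + 1) (by omega),
    hzp (N + N + 2) (by omega), hzp (N + N + 3) (by omega), hzp (N + N + 4) (by omega),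
    hz d _ (by tauto), hz lz _ (by tauto), hz lw _ (by tauto), hx e _ (by tauto),
    hx lx _ (by tauto), hx ly _ (by tauto), List.nil_append, List.cons_append, decide_eq_true_eq,
    if_false, or_true, if_true, List.map_append, List.append_nil]

theorem IsSpot.filter {x y : Letter} {e lx ly : List Letter} (hxy : x ≠ y)
    (h : IsSpot x y e lx ly) {p : Letter} (hp : p ∈ e) :
    e.filter (fun r => r = p) = [p] ∧ (lx ++ ly).filter (fun r => r = p) = [p] := by
  rcases h with ⟨rfl, rfl, rfl⟩ | ⟨rfl, rfl, rfl⟩ | ⟨rfl, rfl, rfl⟩ | ⟨rfl, rfl, rfl⟩ <;>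
    simp at hp <;> (try rcases hp with rfl | rfl) <;> simp [*, hxy.symm]

theorem IsSpot.mem_left {x y : Letter} {e lx ly : List Letter} 
    (h : IsSpot x y e lx ly) {p : Letter} (hp : p ∈ lx ∨ p ∈ ly) : p ∈ e := by
  rcases h with ⟨rfl, rfl, rfl⟩ | ⟨rfl, rfl, rfl⟩ | ⟨rfl, rfl, rfl⟩ | ⟨rfl, rfl, rfl⟩ <;>
    simp at hp <;> simp <;> tauto

theorem IsSpot.exists_mem {x y : Letter} {e lx ly : List Letter} 
    (h : IsSpot x y e lx ly) : ∃ p, p ∈ e ∧ (p = x ∨ p = y) := by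
  rcases h with ⟨rfl, rfl, rfl⟩ | ⟨rfl, rfl, rfl⟩ | ⟨rfl, rfl, rfl⟩ | ⟨rfl, rfl, rfl⟩ <;> simp

theorem mem_wordA (hN : N = n + m + (n + m + 1)) {b : Letter × Kind}
    (hb : b ∈ wordA n m ρ e lx ly d lz lw) :
    (∃ j, j < N + N + 5 ∧ (b.1 = .z j ∨ b.1 = .s j)) ∨ b.1 = .t ∨ b.1 = .s (N + N + 5) ∨
      (b.1 ∈ e ∨ b.1 ∈ lx ∨ b.1 ∈ ly) ∨ (b.1 ∈ d ∨ b.1 ∈ lz ∨ b.1 ∈ lw) := by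
  have hpre : ∀ a k, a + k ≤ N + N + 5 → b ∈ preA a k →
      ∃ j, j < N + N + 5 ∧ (b.1 = .z j ∨ b.1 = .s j) := by
    intro a k hk h
    obtain ⟨i, hi, rfl | rfl⟩ := mem_preA.mp h
    exacts [⟨i, by omega, Or.inl rfl⟩, ⟨i, by omega, Or.inr rfl⟩]
  have hpost : ∀ a k, a + k ≤ N + N + 5 → b ∈ postA a k →
      ∃ j, j < N + N + 5 ∧ (b.1 = .z j ∨ b.1 = .s j) := by
    intro a k hk h
    obtain ⟨i, hi, rfl | rfl⟩ := mem_postA.mp h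
    exacts [⟨i, by omega, Or.inr rfl⟩, ⟨i, by omega, Or.inl rfl⟩]
  have hmid : ∀ a, a ≤ N → b ∈ midA (n + m) a ρ →
      ∃ j, j < N + N + 5 ∧ (b.1 = .z j ∨ b.1 = .s j) := by
    intro a ha h
    obtain ⟨i, hi, rfl⟩ := mem_midA.mp h
    exact ⟨a + i, by omega, Or.inl rfl⟩
  have hmap : ∀ (l : List Letter) (κ : Kind), b ∈ l.map (·, κ) → b.1 ∈ l := by
    intro l κ h
    obtain ⟨r, hr, rfl⟩ := List.mem_map.mp h
    exact hr
  have hz : ∀ j κ, j < N + N + 5 → b = (.z j, κ) →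
      ∃ j, j < N + N + 5 ∧ (b.1 = .z j ∨ b.1 = .s j) := by
    rintro j κ hj rfl
    exact ⟨j, hj, Or.inl rfl⟩
  simp only [wordA, List.mem_append, List.mem_singleton] at hb
  rcases hb with h | h | h | h | h | h | h | h | h | h | h | h | h | h | h | h | h | h | h | h |
    h | h | h | h
  · exact Or.inl (hpre _ _ (by omega) h)
  · exact Or.inl (hpre _ _ (by omega) h)
  · exact Or.inl (hpre _ _ (by omega) h)
  · exact Or.inr (Or.inr (Or.inr (Or.inl (Or.inl (hmap _ _ h)))))
  · exact Or.inr (Or.inl (by rw [h]))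
  · exact Or.inl (hpre _ _ (by omega) h)
  · exact Or.inr (Or.inr (Or.inr (Or.inl (Or.inr (Or.inl (hmap _ _ h))))))
  · exact Or.inr (Or.inr (Or.inr (Or.inr (Or.inl (hmap _ _ h)))))
  · exact Or.inl (hz _ _ (by omega) h)
  · exact Or.inl (hmid _ (by omega) h)
  · exact Or.inr (Or.inr (Or.inr (Or.inl (Or.inr (Or.inr (hmap _ _ h))))))
  · exact Or.inl (hpost _ _ (by omega) h)
  · exact Or.inr (Or.inr (Or.inl (by rw [h])))
  · exact Or.inl (hpre _ _ (by omega) h)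
  · exact Or.inl (hpre _ _ (by omega) h)
  · exact Or.inr (Or.inr (Or.inr (Or.inr (Or.inr (Or.inl (hmap _ _ h))))))
  · exact Or.inl (hz _ _ (by omega) h)
  · exact Or.inl (hz _ _ (by omega) h)
  · exact Or.inl (hz _ _ (by omega) h)
  · exact Or.inl (hz _ _ (by omega) h)
  · exact Or.inl (hmid _ (by omega) h)
  · exact Or.inr (Or.inr (Or.inr (Or.inr (Or.inr (Or.inr (hmap _ _ h))))))
  · exact Or.inl (hpost _ _ (by omega) h)
  · exact Or.inl (hpost _ _ (by omega) h)

/-- The companion of z_j is s_j, that of x and y is t, and that of their analogues is s_{2N+5}.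
Every spot keeps at least one of its two letters, so t and s_{2N+5} still have a partner after a
deletion. -/
theorem paired_wordA (hN : N = n + m + (n + m + 1)) (he : IsSpot .x .y e lx ly)
    (hd : IsSpot (.z (N + N + 5)) (.z (N + N + 6)) d lz lw) :
    Paired (wordA n m ρ e lx ly d lz lw) := by
  have main_x : ∀ p ∈ e, (p = .x ∨ p = .y) ∧
      (wordA n m ρ e lx ly d lz lw).filter (fun b => b.1 = p ∨ b.1 = .t) =
        [(p, .fst), (.t, .lin), (p, .snd)] := by
    intro p hp
    have hp' := he.mem p (Or.inl hp)
    refine ⟨hp', ?_⟩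
    rw [filter_wordA_x he hd hp', (he.filter (by simp) hp).1, (he.filter (by simp) hp).2]
    rfl
  have main_z : ∀ p ∈ d, (p = .z (N + N + 5) ∨ p = .z (N + N + 6)) ∧
      (wordA n m ρ e lx ly d lz lw).filter (fun b => b.1 = p ∨ b.1 = .s (N + N + 5)) =
        [(p, .fst), (.s (N + N + 5), .lin), (p, .snd)] := by
    intro p hp
    have hp' := hd.mem p (Or.inl hp)
    refine ⟨hp', ?_⟩
    rw [filter_wordA_zz he hd hN hp', (hd.filter (by simp) hp).1, (hd.filter (by simp) hp).2]
    rfl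
  intro b hb
  rcases mem_wordA hN hb with ⟨j, hj, h⟩ | h | h | h | h
  · exact ⟨_, _, by simp, h, filter_wordA_idx hN he hd hj⟩
  · obtain ⟨p, hp, -⟩ := he.exists_mem
    obtain ⟨h1, h2⟩ := main_x p hp
    exact ⟨p, .t, by rcases h1 with rfl | rfl <;> simp, Or.inr h, h2⟩
  · obtain ⟨p, hp, -⟩ := hd.exists_mem
    obtain ⟨h1, h2⟩ := main_z p hp
    exact ⟨p, _, by rcases h1 with rfl | rfl <;> simp, Or.inr h, h2⟩
  · have hp : b.1 ∈ e := h.elim id he.mem_left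
    obtain ⟨h1, h2⟩ := main_x _ hp
    exact ⟨b.1, .t, by rcases h1 with h1 | h1 <;> simp [h1], Or.inl rfl, h2⟩
  · have hp : b.1 ∈ d := h.elim id hd.mem_left
    obtain ⟨h1, h2⟩ := main_z _ hp
    exact ⟨b.1, _, by rcases h1 with h1 | h1 <;> simp [h1], Or.inl rfl, h2⟩
end

/-! ### Alternation of first and second occurrences -/

/-- In an alternating permutation of `{0, …, 2p}`, the values less than `p` are at the odd
places. -/
theorem lt_iff_odd_of_alternating {p N : ℕ} (hN : N = p + (p + 1)) {ρ : Equiv.Perm (Fin N)}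
    (hρ : ∀ i j : Fin N, (j : ℕ) = i + 1 →
      ((ρ i : ℕ) < p ∧ p ≤ (ρ j : ℕ)) ∨ ((ρ j : ℕ) < p ∧ p ≤ (ρ i : ℕ)))
    (i : Fin N) : (ρ i : ℕ) < p ↔ Odd (i : ℕ) := by
  have h0 : (⟨0, by omega⟩ : Fin N) = ⟨0, by omega⟩ := rfl
  have step : ∀ k (hk : k < N), ((ρ ⟨k, hk⟩ : ℕ) < p ↔
      (((ρ ⟨0, by omega⟩ : ℕ) < p) ↔ Even k)) := by
    intro k
    induction k with
    | zero => intro hk; simp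
    | succ k ih =>
      intro hk
      have h1 := ih (by omega)
      have h2 := hρ ⟨k, by omega⟩ ⟨k + 1, hk⟩ rfl
      rw [Nat.even_add_one]
      have h3 : (ρ ⟨k + 1, hk⟩ : ℕ) < p ↔ ¬ (ρ ⟨k, by omega⟩ : ℕ) < p := by omega
      rw [h3, h1]
      tauto
  -- A value below p at place 0 would put such values at all p + 1 even places, but there are only p
  -- of them.
  have hz : ¬ (ρ ⟨0, by omega⟩ : ℕ) < p := by
    intro hlt
    have hev : ∀ j : Fin (p + 1), (ρ ⟨2 * j, by omega⟩ : ℕ) < p := by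
      intro j
      rw [step]
      simp [hlt]
    have := Fintype.card_le_of_injective
      (fun j : Fin (p + 1) => (⟨ρ ⟨2 * j, by omega⟩, hev j⟩ : Fin p)) (by
        intro a b hab
        simp only [Fin.mk.injEq] at hab
        have := ρ.injective (Fin.ext hab)
        simp only [Fin.mk.injEq] at this
        exact Fin.ext (by omega))
    simp at this
  have := step i i.2
  rw [this, ← Nat.not_even_iff_odd]
  tauto

/-- Two consecutive occurrences: not both are second ones, and if both are first ones, then of
`x` and `y`, or of their analogues. -/
def Adj (N : ℕ) (a b : Letter × Kind) : Prop :=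
  ¬ (a.2 = .snd ∧ b.2 = .snd) ∧ (a.2 = .fst → b.2 = .fst →
    (a.1 = .x ∧ b.1 = .y) ∨ (a.1 = .y ∧ b.1 = .x) ∨
    (a.1 = .z (N + N + 5) ∧ b.1 = .z (N + N + 6)) ∨
    (a.1 = .z (N + N + 6) ∧ b.1 = .z (N + N + 5)))

theorem Adj.of_lin_left {N : ℕ} {a b : Letter × Kind} (h : a.2 = .lin) : Adj N a b := by
  simp [Adj, h]

theorem Adj.of_lin_right {N : ℕ} {a b : Letter × Kind} (h : b.2 = .lin) : Adj N a b := by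
  simp [Adj, h]

theorem isChain_preA_append {N a k : ℕ} {L : List (Letter × Kind)} (h : L.IsChain (Adj N)) :
    (preA a k ++ L).IsChain (Adj N) := by
  induction k generalizing a with
  | zero => simpa [preA] using h
  | succ k ih =>
    have : preA a (k + 1) = (.z a, .fst) :: (.s a, .lin) :: preA (a + 1) k := by
      simp [preA, List.range'_succ]
    rw [this, List.cons_append, List.cons_append, List.isChain_cons_cons, List.isChain_cons]
    exact ⟨Adj.of_lin_right rfl, fun _ _ => Adj.of_lin_left rfl, ih⟩

theorem head_postA_append {a k : ℕ} {L : List (Letter × Kind)}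
    (hL : ∀ b ∈ L.head?, b.2 = .lin) : ∀ b ∈ (postA a k ++ L).head?, b.2 = .lin := by
  cases k with
  | zero => simpa [postA] using hL
  | succ k => simp [postA, List.range'_succ]

theorem isChain_postA_append {N a k : ℕ} {L : List (Letter × Kind)} (h : L.IsChain (Adj N))
    (hL : ∀ b ∈ L.head?, b.2 = .lin) : (postA a k ++ L).IsChain (Adj N) := by
  induction k generalizing a with
  | zero => simpa [postA] using h
  | succ k ih =>
    have : postA a (k + 1) = (.s a, .lin) :: (.z a, .snd) :: postA (a + 1) k := by
      simp [postA, List.range'_succ]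
    rw [this, List.cons_append, List.cons_append, List.isChain_cons_cons, List.isChain_cons]
    exact ⟨Adj.of_lin_left rfl, fun b hb => Adj.of_lin_right (head_postA_append hL b hb), ih⟩

section
variable {p N o : ℕ} {ρ : Equiv.Perm (Fin N)}

theorem midA_eq_cons (hN : N = p + (p + 1))
    (hρ : ∀ i : Fin N, (ρ i : ℕ) < p ↔ Odd (i : ℕ)) :
    ∃ i, p ≤ i ∧ i < N ∧ ∃ L, midA p o ρ = (.z (o + i), .fst) :: L := by
  subst hN
  refine ⟨ρ ⟨0, by omega⟩, ?_, (ρ _).2, ?_⟩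
  · have := hρ ⟨0, by omega⟩
    simp at this
    exact this
  · have := hρ ⟨0, by omega⟩
    refine ⟨_, by
      rw [midA]
      change List.ofFn (n := p + p + 1) _ = _
      rw [List.ofFn_succ]
      congr 2
      rw [if_neg]
      rw [hρ]
      simp⟩

theorem midA_eq_concat (hN : N = p + (p + 1))
    (hρ : ∀ i : Fin N, (ρ i : ℕ) < p ↔ Odd (i : ℕ)) :
    ∃ i, p ≤ i ∧ i < N ∧ ∃ L, midA p o ρ = L ++ [(.z (o + i), .fst)] := by
  subst hN
  have hlast : ¬ (ρ ⟨p + p, by omega⟩ : ℕ) < p := by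
    rw [hρ]
    simp
  refine ⟨ρ ⟨p + p, by omega⟩, by omega, (ρ _).2, ?_⟩
  refine ⟨_, by
    rw [midA]
    change List.ofFn (n := p + p + 1) _ = _
    rw [List.ofFn_succ_last]
    congr 3
    exact if_neg hlast⟩

/-- Inside the block the kind depends on the parity of the place. The number of places is odd, so
the block begins and ends with a first occurrence, and no other first occurrence may follow it. -/
theorem isChain_midA_append (hN : N = p + (p + 1))
    (hρ : ∀ i : Fin N, (ρ i : ℕ) < p ↔ Odd (i : ℕ)) {M : ℕ} {L : List (Letter × Kind)}
    (h : L.IsChain (Adj M)) (hL : ∀ b ∈ L.head?, b.2 ≠ .fst) :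
    (midA p o ρ ++ L).IsChain (Adj M) := by
  rw [List.isChain_append]
  refine ⟨?_, h, ?_⟩
  · rw [List.isChain_iff_getElem]
    intro i hi
    have hi' : i + 1 < N := by simpa [midA] using hi
    have h1 := hρ ⟨i, by omega⟩
    have h2 := hρ ⟨i + 1, hi'⟩
    simp only [midA, List.getElem_ofFn]
    by_cases h3 : Odd i
    · have h4 : ¬ Odd (i + 1) := by
        rw [Nat.not_odd_iff_even]; exact h3.add_one
      simp [Adj, h1, h2, h3, h4]
    · have h4 : Odd (i + 1) := (Nat.not_odd_iff_even.mp h3).add_one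
      simp [Adj, h1, h2, h3, h4]
  · obtain ⟨i, -, -, L', hL'⟩ := midA_eq_concat (o := o) hN hρ
    intro b hb b' hb'
    rw [hL'] at hb
    simp at hb
    subst hb
    exact ⟨by simp, fun _ h => absurd h (hL b' hb')⟩

theorem head_midA_append (hN : N = p + (p + 1))
    (hρ : ∀ i : Fin N, (ρ i : ℕ) < p ↔ Odd (i : ℕ)) {L : List (Letter × Kind)} :
    ∀ b ∈ (midA p o ρ ++ L).head?, b.2 = .fst := by
  obtain ⟨i, -, -, L', hL'⟩ := midA_eq_cons (o := o) hN hρ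
  rw [hL']
  simp

end

/-- The chain is built from the right, because each join depends only on the head of what follows.
The second occurrence of z_{2N} separates d from the first occurrence opening the permuted block. In
the second copy the added letters have kinds first, second, first, second, fitting between the
second occurrence of z_{2N+5}, if present, and the block. -/
theorem isChain_wordA {n m N : ℕ} {ρ : Equiv.Perm (Fin N)} {e lx ly d lz lw : List Letter}
    (hN : N = n + m + (n + m + 1)) (hρ : ∀ i : Fin N, (ρ i : ℕ) < n + m ↔ Odd (i : ℕ))
    (he : IsSpot .x .y e lx ly) (hd : IsSpot (.z (N + N + 5)) (.z (N + N + 6)) d lz lw) :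
    (wordA n m ρ e lx ly d lz lw).IsChain (Adj N) := by
  have c1 : (postA (N + n + m) (n + m + 1) ++ postA (N + N + 3) 2).IsChain (Adj N) :=
    isChain_postA_append (by simpa using isChain_postA_append (L := []) (by simp) (by simp))
      (by simpa using head_postA_append (L := []) (by simp))
  have h1 : ∀ b ∈ (postA (N + n + m) (n + m + 1) ++ postA (N + N + 3) 2).head?, b.2 = .lin :=
    head_postA_append (by simpa using head_postA_append (L := []) (by simp))
  unfold wordA
  generalize postA (N + n + m) (n + m + 1) ++ postA (N + N + 3) 2 = L at c1 h1 ⊢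
  have c2 : (lw.map (·, Kind.snd) ++ L).IsChain (Adj N) := by
    rcases hd with ⟨-, -, rfl⟩ | ⟨-, -, rfl⟩ | ⟨-, -, rfl⟩ | ⟨-, -, rfl⟩ <;>
      simp [List.isChain_cons, c1] <;> exact fun b κ hb => Adj.of_lin_right (h1 _ hb)
  have h2 : ∀ b ∈ (lw.map (·, Kind.snd) ++ L).head?, b.2 ≠ .fst := by
    rcases hd with ⟨-, -, rfl⟩ | ⟨-, -, rfl⟩ | ⟨-, -, rfl⟩ | ⟨-, -, rfl⟩ <;>
      simp <;> exact fun b κ hb => by have := h1 _ hb; simp only at this; simp [this]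
  generalize lw.map (·, Kind.snd) ++ L = L at c2 h2 ⊢
  have c3 := isChain_midA_append (o := N) hN hρ c2 h2
  have h3 := head_midA_append (o := N) (L := L) hN hρ
  generalize midA (n + m) N ρ ++ L = L at c3 h3 ⊢
  have c4 : ([((.z (N + N + 3), .fst) : Letter × Kind)] ++ ([(Letter.z (N + N + 1), Kind.snd)] ++
      ([(Letter.z (N + N + 4), Kind.fst)] ++ ([(Letter.z (N + N + 2), Kind.snd)] ++ L)))).IsChain (Adj N) := by
    simp only [List.singleton_append, List.isChain_cons_cons, List.isChain_cons (x := (Letter.z (N + N + 2), Kind.snd))]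
    refine ⟨by simp [Adj], by simp [Adj], by simp [Adj], fun b hb => ?_, c3⟩
    exact ⟨by simp [h3 b hb], by simp⟩
  have c5 : (lz.map (·, Kind.snd) ++ ([((.z (N + N + 3), .fst) : Letter × Kind)] ++
      ([(Letter.z (N + N + 1), Kind.snd)] ++ ([(Letter.z (N + N + 4), Kind.fst)] ++
      ([(Letter.z (N + N + 2), Kind.snd)] ++ L))))).IsChain (Adj N) := by
    rcases hd with ⟨-, rfl, -⟩ | ⟨-, rfl, -⟩ | ⟨-, rfl, -⟩ | ⟨-, rfl, -⟩
    · exact List.isChain_cons_cons.mpr ⟨by simp [Adj], c4⟩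
    · exact List.isChain_cons_cons.mpr ⟨by simp [Adj], c4⟩
    · exact List.isChain_cons_cons.mpr ⟨by simp [Adj], c4⟩
    · exact c4
  generalize lz.map (·, Kind.snd) ++ _ = L at c5 ⊢
  have c6 : ([((.s (N + N + 5), .lin) : Letter × Kind)] ++ (preA (N + n) m ++
      (preA (N + N + 1) 2 ++ L))).IsChain (Adj N) := by
    rw [List.singleton_append, List.isChain_cons]
    exact ⟨fun b _ => Adj.of_lin_left rfl, isChain_preA_append (isChain_preA_append c5)⟩
  have c7 := isChain_postA_append (a := n + m) (k := n + m + 1) c6 (by simp)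
  have h7 : ∀ b ∈ (postA (n + m) (n + m + 1) ++ ([((.s (N + N + 5), .lin) : Letter × Kind)] ++
    (preA (N + n) m ++ (preA (N + N + 1) 2 ++ L)))).head?, b.2 = .lin :=
    head_postA_append (by simp)
  generalize postA (n + m) (n + m + 1) ++ _ = L at c7 h7 ⊢
  have c8 : (ly.map (·, Kind.snd) ++ L).IsChain (Adj N) := by
    rcases he with ⟨-, -, rfl⟩ | ⟨-, -, rfl⟩ | ⟨-, -, rfl⟩ | ⟨-, -, rfl⟩ <;>
      simp [List.isChain_cons, c7] <;> exact fun b κ hb => Adj.of_lin_right (h7 _ hb)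
  have h8 : ∀ b ∈ (ly.map (·, Kind.snd) ++ L).head?, b.2 ≠ .fst := by
    rcases he with ⟨-, -, rfl⟩ | ⟨-, -, rfl⟩ | ⟨-, -, rfl⟩ | ⟨-, -, rfl⟩ <;>
      simp <;> exact fun b κ hb => by have := h7 _ hb; simp only at this; simp [this]
  generalize ly.map (·, Kind.snd) ++ L = L at c8 h8 ⊢
  have c9 := isChain_midA_append (o := 0) hN hρ c8 h8
  have h9 := head_midA_append (o := 0) (L := L) hN hρ
  generalize midA (n + m) 0 ρ ++ L = L at c9 h9 ⊢
  have c10 : (((.z (N + N), .snd) : Letter × Kind) :: L).IsChain (Adj N) := by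
    rw [List.isChain_cons]
    exact ⟨fun b hb => ⟨by simp [h9 b hb], by simp⟩, c9⟩
  have c11 : (d.map (·, Kind.fst) ++ ([((.z (N + N), .snd) : Letter × Kind)] ++ L)).IsChain
      (Adj N) ∧ ∀ b ∈ (d.map (·, Kind.fst) ++
      ([((.z (N + N), .snd) : Letter × Kind)] ++ L)).head?, b.2 = .fst := by
    rcases hd with ⟨rfl, -, -⟩ | ⟨rfl, -, -⟩ | ⟨rfl, -, -⟩ | ⟨rfl, -, -⟩ <;>
      simp [List.isChain_cons_cons, c10] <;> simp [Adj]
  generalize d.map (·, Kind.fst) ++ _ = L at c11 ⊢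
  have c12 : (lx.map (·, Kind.snd) ++ L).IsChain (Adj N) := by
    have : ∀ b ∈ L.head?, Adj N (.x, .snd) b := fun b hb => ⟨by simp [c11.2 b hb], by simp⟩
    rcases he with ⟨-, rfl, -⟩ | ⟨-, rfl, -⟩ | ⟨-, rfl, -⟩ | ⟨-, rfl, -⟩
    · exact List.isChain_cons.mpr ⟨this, c11.1⟩
    · exact List.isChain_cons.mpr ⟨this, c11.1⟩
    · exact List.isChain_cons.mpr ⟨this, c11.1⟩
    · exact c11.1
  have c13 : (((.t, .lin) : Letter × Kind) :: (preA n m ++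
      (lx.map (·, Kind.snd) ++ L))).IsChain (Adj N) := by
    rw [List.isChain_cons]
    exact ⟨fun b _ => Adj.of_lin_left rfl, isChain_preA_append c12⟩
  refine isChain_preA_append (isChain_preA_append (isChain_preA_append ?_))
  rcases he with ⟨rfl, -, -⟩ | ⟨rfl, -, -⟩ | ⟨rfl, -, -⟩ | ⟨rfl, -, -⟩ <;>
    simp [List.isChain_cons_cons, c13] <;> simp [Adj]

/-! ### The test word without annotations, and the detecting factors of c -/

def pre (a k : ℕ) : List Letter := (List.range' a k).flatMap fun i => [.z i, .s i]

def post (a k : ℕ) : List Letter := (List.range' a k).flatMap fun i => [.s i, .z i]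

def mid (o : ℕ) {N : ℕ} (ρ : Equiv.Perm (Fin N)) : List Letter := List.ofFn fun i => .z (o + ρ i)

theorem map_fst_preA (a k : ℕ) : (preA a k).map Prod.fst = pre a k := by
  simp [preA, pre, List.map_flatMap]

theorem map_fst_postA (a k : ℕ) : (postA a k).map Prod.fst = post a k := by
  simp [postA, post, List.map_flatMap]

theorem map_fst_midA (p o : ℕ) {N : ℕ} (ρ : Equiv.Perm (Fin N)) :
    (midA p o ρ).map Prod.fst = mid o ρ := by
  simp [midA, mid, List.map_ofFn, Function.comp_def]

theorem mem_pre {a k : ℕ} {r : Letter} :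
    r ∈ pre a k ↔ ∃ i, (a ≤ i ∧ i < a + k) ∧ (r = .z i ∨ r = .s i) := by
  simp [pre, List.mem_range'_1]

theorem mem_post {a k : ℕ} {r : Letter} :
    r ∈ post a k ↔ ∃ i, (a ≤ i ∧ i < a + k) ∧ (r = .s i ∨ r = .z i) := by
  simp [post, List.mem_range'_1]

theorem mem_mid {o N : ℕ} {ρ : Equiv.Perm (Fin N)} {r : Letter} :
    r ∈ mid o ρ ↔ ∃ i, i < N ∧ r = .z (o + i) := by
  rw [← map_fst_midA 0, List.mem_map]
  constructor
  · rintro ⟨b, hb, rfl⟩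
    obtain ⟨i, hi, rfl⟩ := mem_midA.mp hb
    exact ⟨i, hi, rfl⟩
  · rintro ⟨i, hi, rfl⟩
    exact ⟨_, mem_midA.mpr ⟨i, hi, rfl⟩, rfl⟩

theorem nodup_mid (o : ℕ) {N : ℕ} (ρ : Equiv.Perm (Fin N)) : (mid o ρ).Nodup := by
  rw [mid, List.nodup_ofFn]
  intro i j h
  simp only [Letter.z.injEq] at h
  exact ρ.injective (Fin.ext (by omega))

theorem post_split {a k i : ℕ} (h1 : a ≤ i) (h2 : i < a + k) :
    post a k = post a (i - a) ++ .s i :: .z i :: post (i + 1) (a + k - (i + 1)) := by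
  have : List.range' a k = List.range' a (i - a) ++ i :: List.range' (i + 1) (a + k - (i + 1)) := by
    rw [← List.range'_succ, show a + k - (i + 1) + 1 = a + k - i by omega]
    conv_rhs => rw [show List.range' i (a + k - i) = List.range' (a + 1 * (i - a)) (a + k - i) by
      rw [show a + 1 * (i - a) = i by omega]]
    rw [List.range'_append]
    congr 1
    omega
  simp [post, this]

/-- The word `c_{n,m,n+m+1}[ρ]` as a list. -/
def cList (n m : ℕ) {N : ℕ} (ρ : Equiv.Perm (Fin N)) : List Letter :=
  pre 0 n ++ ([.x, .y] ++ ((.t :: pre n m) ++ (.x :: (mid 0 ρ ++ (.y :: post (n + m) (n + m + 1))))))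

theorem toList_cWord (n m : ℕ) (ρ : Equiv.Perm (Fin (n + m + (n + m + 1)))) :
    FreeMonoid.toList (cWord n m (n + m + 1) ρ) = cList n m ρ := by
  simp [cWord, cList, pre, mid, post]

section
variable {n m N : ℕ} {ρ : Equiv.Perm (Fin N)}

/-- The factor xy tests linear letters. The first and the last letter of the permuted block have
index at least n + m, so they recur in the final part of c. The factor from the first x to the
recurrence of the first block letter, with t as the marker r, gives `snd_fst`; the one from the
first y to the recurrence of the last block letter gives `fst_snd`. -/
theorem detects_cList (hN : N = n + m + (n + m + 1))
    (hρ : ∀ i : Fin N, (ρ i : ℕ) < n + m ↔ Odd (i : ℕ)) : Detects (cList n m ρ) := by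
  refine ⟨⟨.x, .y, by simp, pre 0 n, _, by rw [cList, List.append_assoc]⟩, ?_, ?_⟩
  · obtain ⟨i, h1, h2, L, hL⟩ := midA_eq_cons (o := 0) hN hρ
    have hm : mid 0 ρ = .z i :: L.map Prod.fst := by
      rw [← map_fst_midA (n + m), hL]; simp
    have hnd := nodup_mid 0 ρ
    have hml : ∀ r ∈ L.map Prod.fst, ∃ j, r = .z j := by
      intro r hr
      have : r ∈ mid 0 ρ := by rw [hm]; exact List.mem_cons_of_mem _ hr
      obtain ⟨j, -, h⟩ := mem_mid.mp this
      exact ⟨_, h⟩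
    rw [hm, List.nodup_cons] at hnd
    generalize L.map Prod.fst = L at hm hnd hml
    refine ⟨.x, .z i, .t, .y :: .t :: pre n m, L ++ .y :: (post (n + m) (i - (n + m)) ++ [.s i]),
      by simp, by simp, ?_, ?_, ?_, ?_, ?_⟩
    · have : (pre n m).filter (fun a => a = .x ∨ a = .t) = [] :=
        filter_nil_of_notMem (by simp [mem_pre]) (by simp [mem_pre])
      simp [-Bool.decide_or, this]
    · simp [mem_pre]; omega
    · simp [mem_post]
      intro h; obtain ⟨j, hj⟩ := hml _ h; simp at hj
    · simp [mem_post, hnd.1]; omega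
    · refine ⟨pre 0 n, post (i + 1) (n + m + (n + m + 1) - (i + 1)), ?_⟩
      rw [cList, post_split h1 (show i < n + m + (n + m + 1) by omega), hm]
      simp
  · obtain ⟨i, h1, h2, L, hL⟩ := midA_eq_concat (o := 0) hN hρ
    have hm : mid 0 ρ = L.map Prod.fst ++ [.z i] := by
      rw [← map_fst_midA (n + m), hL]; simp
    have hnd := nodup_mid 0 ρ
    have hml : ∀ r ∈ L.map Prod.fst, ∃ j, r = .z j := by
      intro r hr
      have : r ∈ mid 0 ρ := by rw [hm]; exact List.mem_append_left _ hr
      obtain ⟨j, -, h⟩ := mem_mid.mp this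
      exact ⟨_, h⟩
    rw [hm, List.nodup_append] at hnd
    generalize L.map Prod.fst = L at hm hnd hml
    refine ⟨.z i, .y, .t :: (pre n m ++ .x :: L), post (n + m) (i - (n + m)) ++ [.s i],
      by simp, ?_, ?_, ?_, ?_, ?_⟩
    · simp only [List.mem_cons, List.mem_append, mem_pre, reduceCtorEq, false_or, not_or]
      refine ⟨?_, fun h => hnd.2.2 _ h _ (by simp) rfl⟩
      simp; omega
    · simp only [List.mem_cons, List.mem_append, mem_pre, reduceCtorEq, false_or, not_or]
      refine ⟨by simp, fun h => ?_⟩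
      obtain ⟨j, hj⟩ := hml _ h; simp at hj
    · simp [mem_post]; omega
    · simp [mem_post]
    · refine ⟨pre 0 n ++ [.x], post (i + 1) (n + m + (n + m + 1) - (i + 1)), ?_⟩
      rw [cList, post_split h1 (show i < n + m + (n + m + 1) by omega), hm]
      simp

variable (n m ρ)

/-- The sizes of the pieces serve to keep the two exchanges apart. `wF` has N + 4 letters, one more
than d and `wB` together. On the other hand n + 1 letters of `wB` already occur in `wA`, namely
z_{2N} and z_j for j < n, but only n letters of `wF` do. -/
def wA : List Letter := pre 0 n ++ (pre (N + N) 1 ++ pre N n)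
def wC : List Letter := .t :: pre n m
def wB : List Letter := .z (N + N) :: mid 0 ρ
def wD : List Letter :=
  post (n + m) (n + m + 1) ++ (.s (N + N + 5) :: (pre (N + n) m ++ pre (N + N + 1) 2))
def wF : List Letter :=
  .z (N + N + 3) :: .z (N + N + 1) :: .z (N + N + 4) :: .z (N + N + 2) :: mid N ρ
def wG : List Letter := post (N + n + m) (n + m + 1) ++ post (N + N + 3) 2

/-- The test word with open places. -/
def word (e lx ly d lz lw : List Letter) : List Letter :=
  wA n (N := N) ++ (e ++ (wC n m ++ (lx ++ (d ++ (wB ρ ++ (ly ++ (wD n m (N := N) ++ (lz ++ (wF ρ ++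
    (lw ++ wG n m (N := N)))))))))))

variable {n m ρ}

theorem map_fst_wordA (e lx ly d lz lw : List Letter) :
    (wordA n m ρ e lx ly d lz lw).map Prod.fst = word n m ρ e lx ly d lz lw := by
  simp [wordA, word, wA, wB, wC, wD, wF, wG, map_fst_preA, map_fst_postA, map_fst_midA,
    Function.comp_def]

theorem notMem_pieces (hN : N = n + m + (n + m + 1)) {r : Letter}
    (hr : (r = .x ∨ r = .y) ∨ (r = .z (N + N + 5) ∨ r = .z (N + N + 6))) :
    r ∉ wA n (N := N) ∧ r ∉ wC n m ∧ r ∉ wB ρ ∧ r ∉ wD n m (N := N) ∧ r ∉ wF ρ ∧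
      r ∉ wG n m (N := N) := by
  rcases hr with (rfl | rfl) | (rfl | rfl)
  · simp [wA, wC, wB, wD, wF, wG, mem_pre, mem_post, mem_mid]
  · simp [wA, wC, wB, wD, wF, wG, mem_pre, mem_post, mem_mid]
  · simp [wA, wC, wB, wD, wF, wG, mem_pre, mem_post, mem_mid]
    repeat' apply And.intro
    all_goals intros
    all_goals omega
  · simp [wA, wC, wB, wD, wF, wG, mem_pre, mem_post, mem_mid]
    repeat' apply And.intro
    all_goals intros
    all_goals omega

theorem filter_ne_of_notMem {L : List Letter} {r : Letter} (h : r ∉ L) :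
    L.filter (fun a => a ≠ r) = L := by
  rw [List.filter_eq_self]
  intro a ha
  simp
  rintro rfl
  exact h ha

theorem filter_ne_word (hN : N = n + m + (n + m + 1)) {r : Letter}
    (hr : (r = .x ∨ r = .y) ∨ (r = .z (N + N + 5) ∨ r = .z (N + N + 6)))
    (e lx ly d lz lw : List Letter) :
    (word n m ρ e lx ly d lz lw).filter (fun a => a ≠ r) =
      word n m ρ (e.filter (fun a => a ≠ r)) (lx.filter (fun a => a ≠ r))
        (ly.filter (fun a => a ≠ r)) (d.filter (fun a => a ≠ r)) (lz.filter (fun a => a ≠ r))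
        (lw.filter (fun a => a ≠ r)) := by
  obtain ⟨h1, h2, h3, h4, h5, h6⟩ := notMem_pieces (ρ := ρ) hN hr
  simp only [word, List.filter_append, filter_ne_of_notMem h1, filter_ne_of_notMem h2,
    filter_ne_of_notMem h3, filter_ne_of_notMem h4, filter_ne_of_notMem h5, filter_ne_of_notMem h6]

/-- Deletion of letters is itself a substitution and can be absorbed into the test. -/
theorem FactorEq.filter {c u v : List Letter} (h : FactorEq c u v) (P : Letter → Prop)
    [DecidablePred P] : FactorEq c (u.filter P) (v.filter P) := by
  intro φ
  have key : ∀ l : List Letter, (l.filter P).flatMap φ =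
      l.flatMap (fun a => if P a then φ a else []) := by
    intro l
    induction l with
    | nil => rfl
    | cons a l ih =>
      by_cases ha : P a <;> simp [ha, ih]
  rw [key, key]
  exact h _

/-- If neither both `x` and `y` nor both of their analogues are present, then the test word is
determined by the tests. -/
theorem FactorEq.eq_word (hN : N = n + m + (n + m + 1))
    (hρ : ∀ i : Fin N, (ρ i : ℕ) < n + m ↔ Odd (i : ℕ)) {e lx ly d lz lw v : List Letter}
    (he : IsSpot .x .y e lx ly) (hd : IsSpot (.z (N + N + 5)) (.z (N + N + 6)) d lz lw)
    (he' : ¬ (.x ∈ e ∧ .y ∈ e)) (hd' : ¬ (.z (N + N + 5) ∈ d ∧ .z (N + N + 6) ∈ d))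
    (h : FactorEq (cList n m ρ) (word n m ρ e lx ly d lz lw) v) :
    v = word n m ρ e lx ly d lz lw := by
  have hchain := isChain_wordA (ρ := ρ) hN hρ he hd
  have hmem : ∀ r, (r = .x ∨ r = .y) → (∃ κ, (r, κ) ∈ wordA n m ρ e lx ly d lz lw) → r ∈ e := by
    rintro r hr ⟨κ, hb⟩
    rcases mem_wordA hN hb with ⟨j, hj, h⟩ | h | h | h | h
    · rcases hr with rfl | rfl <;> simp at h
    · rcases hr with rfl | rfl <;> simp at h
    · rcases hr with rfl | rfl <;> simp at h
    · exact h.elim id he.mem_left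
    · have := hd.mem _ h
      rcases hr with rfl | rfl <;> simp at this
  have hmem' : ∀ r, (r = .z (N + N + 5) ∨ r = .z (N + N + 6)) →
      (∃ κ, (r, κ) ∈ wordA n m ρ e lx ly d lz lw) → r ∈ d := by
    rintro r hr ⟨κ, hb⟩
    rcases mem_wordA hN hb with ⟨j, hj, h⟩ | h | h | h | h
    · rcases hr with rfl | rfl <;> simp at h <;> omega
    · rcases hr with rfl | rfl <;> simp at h
    · rcases hr with rfl | rfl <;> simp at h
    · have := he.mem _ h
      rcases hr with rfl | rfl <;> simp at this
    · exact h.elim id hd.mem_left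
  have hadj : ∀ A a b D, wordA n m ρ e lx ly d lz lw = A ++ a :: b :: D → Adj N a b := by
    intro A a b D hs
    rw [hs, List.isChain_append] at hchain
    exact (List.isChain_cons_cons.mp hchain.2.1).1
  rw [← map_fst_wordA] at h ⊢
  refine h.eq (detects_cList hN hρ) (paired_wordA hN he hd) ?_ ?_
  · intro A p q D hs
    have hp : ∃ κ, (p, κ) ∈ wordA n m ρ e lx ly d lz lw := ⟨.fst, by simp [hs]⟩
    have hq : ∃ κ, (q, κ) ∈ wordA n m ρ e lx ly d lz lw := ⟨.fst, by simp [hs]⟩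
    rcases (hadj _ _ _ _ hs).2 rfl rfl with ⟨h1, h2⟩ | ⟨h1, h2⟩ | ⟨h1, h2⟩ | ⟨h1, h2⟩ <;>
      simp only at h1 h2 <;> subst h1 h2
    · exact he' ⟨hmem _ (by simp) hp, hmem _ (by simp) hq⟩
    · exact he' ⟨hmem _ (by simp) hq, hmem _ (by simp) hp⟩
    · exact hd' ⟨hmem' _ (by simp) hp, hmem' _ (by simp) hq⟩
    · exact hd' ⟨hmem' _ (by simp) hq, hmem' _ (by simp) hp⟩
  · intro A p q D hs
    exact (hadj _ _ _ _ hs).1 ⟨rfl, rfl⟩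

end

/-! ### What the identities of V can do to a test word -/

section
variable (n m : ℕ) {N : ℕ} (ρ : Equiv.Perm (Fin N))

/-- The test word with the orders `e` and `d` of the two pairs of adjacent first occurrences. -/
def full (e d : List Letter) : List Letter :=
  word n m ρ e [.x] [.y] d [.z (N + N + 5)] [.z (N + N + 6)]

/-- `l` consists of the letters `p` and `q` in one of the two orders. -/
def IsOrder (p q : Letter) (l : List Letter) : Prop := l = [p, q] ∨ l = [q, p]

variable {n m ρ}

theorem IsOrder.isSpot {p q : Letter} {l : List Letter} (h : IsOrder p q l) :
    IsSpot p q l [p] [q] := by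
  rcases h with rfl | rfl
  · exact Or.inl ⟨rfl, rfl, rfl⟩
  · exact Or.inr (Or.inl ⟨rfl, rfl, rfl⟩)

/-- Deleting either analogue leaves a word without adjacent first occurrences, hence one determined
by the tests. The two results recover v up to the order of the analogues. -/
theorem FactorEq.eq_word_or (hN : N = n + m + (n + m + 1))
    (hρ : ∀ i : Fin N, (ρ i : ℕ) < n + m ↔ Odd (i : ℕ)) {e lx ly d v : List Letter}
    (he : IsSpot .x .y e lx ly) (he' : ¬ (.x ∈ e ∧ .y ∈ e))
    (hd : IsOrder (.z (N + N + 5)) (.z (N + N + 6)) d)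
    (h : FactorEq (cList n m ρ) (word n m ρ e lx ly d [.z (N + N + 5)] [.z (N + N + 6)]) v) :
    ∃ d', IsOrder (.z (N + N + 5)) (.z (N + N + 6)) d' ∧
      v = word n m ρ e lx ly d' [.z (N + N + 5)] [.z (N + N + 6)] := by
  have hne : ∀ r, r = Letter.z (N + N + 5) ∨ r = .z (N + N + 6) → r ∉ e ∧ r ∉ lx ∧ r ∉ ly := by
    intro r hr
    have : ¬ (r = .x ∨ r = .y) := by rcases hr with rfl | rfl <;> simp
    exact ⟨fun h => this (he.mem r (Or.inl h)), fun h => this (he.mem r (Or.inr (Or.inl h))),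
      fun h => this (he.mem r (Or.inr (Or.inr h)))⟩
  have h1 := hne _ (Or.inl rfl)
  have h2 := hne _ (Or.inr rfl)
  obtain ⟨a1, a2, a3, a4, a5, a6⟩ :=
    notMem_pieces (ρ := ρ) hN (r := .z (N + N + 5)) (Or.inr (Or.inl rfl))
  obtain ⟨b1, b2, b3, b4, b5, b6⟩ :=
    notMem_pieces (ρ := ρ) hN (r := .z (N + N + 6)) (Or.inr (Or.inr rfl))
  have f1 := h.filter (fun a => a ≠ .z (N + N + 5))
  rw [filter_ne_word hN (by simp), filter_ne_of_notMem h1.1, filter_ne_of_notMem h1.2.1,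
    filter_ne_of_notMem h1.2.2] at f1
  have e1 := f1.eq_word hN hρ he (by rcases hd with rfl | rfl <;> simp [IsSpot]) he'
    (by rcases hd with rfl | rfl <;> simp)
  have f2 := h.filter (fun a => a ≠ .z (N + N + 6))
  rw [filter_ne_word hN (by simp), filter_ne_of_notMem h2.1, filter_ne_of_notMem h2.2.1,
    filter_ne_of_notMem h2.2.2] at f2
  have e2 := f2.eq_word hN hρ he (by rcases hd with rfl | rfl <;> simp [IsSpot]) he'
    (by rcases hd with rfl | rfl <;> simp)
  have := eq_or_eq_of_filter_ne (x := .z (N + N + 5)) (y := .z (N + N + 6)) (by simp)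
    (A := wA n (N := N) ++ e ++ wC n m ++ lx) (C := wB ρ ++ ly ++ wD n m (N := N)) (E := wF ρ)
    (D := wG n m (N := N)) (v := v) (by simp [wB]) (by simp [wF])
    (by simp [a1, a2, a3, a4, a5, a6, h1]) (by simp [b1, b2, b3, b4, b5, b6, h2])
    (by rw [e1]; rcases hd with rfl | rfl <;> simp [word])
    (by rw [e2]; rcases hd with rfl | rfl <;> simp [word])
  rcases this with h | h
  · exact ⟨_, Or.inl rfl, by rw [h]; simp [word]⟩
  · exact ⟨_, Or.inr rfl, by rw [h]; simp [word]⟩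

/-- Here x and y are deleted in turn, and each time `FactorEq.eq_word_or` determines the result up
to the order of the analogues. -/
theorem FactorEq.eq_full (hN : N = n + m + (n + m + 1))
    (hρ : ∀ i : Fin N, (ρ i : ℕ) < n + m ↔ Odd (i : ℕ)) {e d v : List Letter}
    (he : IsOrder .x .y e) (hd : IsOrder (.z (N + N + 5)) (.z (N + N + 6)) d)
    (h : FactorEq (cList n m ρ) (full n m ρ e d) v) :
    ∃ e' d', IsOrder .x .y e' ∧ IsOrder (.z (N + N + 5)) (.z (N + N + 6)) d' ∧
      v = full n m ρ e' d' := by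
  obtain ⟨a1, a2, a3, a4, a5, a6⟩ := notMem_pieces (ρ := ρ) hN (r := .x) (Or.inl (Or.inl rfl))
  obtain ⟨b1, b2, b3, b4, b5, b6⟩ := notMem_pieces (ρ := ρ) hN (r := .y) (Or.inl (Or.inr rfl))
  have hdx : ∀ r, r = Letter.x ∨ r = .y → ∀ d, IsOrder (.z (N + N + 5)) (.z (N + N + 6)) d →
      d.filter (fun a => a ≠ r) = d := by
    rintro r hr d (rfl | rfl) <;> rcases hr with rfl | rfl <;> rfl
  have f1 := h.filter (fun a => a ≠ .x)
  rw [full, filter_ne_word hN (by simp), hdx _ (by simp) d hd] at f1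
  obtain ⟨d1, hd1, e1⟩ := FactorEq.eq_word_or hN hρ
    (by rcases he with rfl | rfl <;> simp [IsSpot]) (by rcases he with rfl | rfl <;> simp) hd f1
  have f2 := h.filter (fun a => a ≠ .y)
  rw [full, filter_ne_word hN (by simp), hdx _ (by simp) d hd] at f2
  obtain ⟨d2, hd2, e2⟩ := FactorEq.eq_word_or hN hρ
    (by rcases he with rfl | rfl <;> simp [IsSpot]) (by rcases he with rfl | rfl <;> simp) hd f2
  have ex : e.filter (fun a => a ≠ .x) = [.y] := by rcases he with rfl | rfl <;> rfl
  have ey : e.filter (fun a => a ≠ .y) = [.x] := by rcases he with rfl | rfl <;> rfl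
  -- Both orders are read off from the same v: deleting x and y together, in either sequence, leaves
  -- d1 and d2 at the same place.
  have hdd : d1 = d2 := by
    have c1 := congrArg (List.filter (fun a => a ≠ Letter.y)) e1
    have c2 := congrArg (List.filter (fun a => a ≠ Letter.x)) e2
    rw [List.filter_comm, c2, filter_ne_word hN (by simp), filter_ne_word hN (by simp),
      hdx _ (by simp) d1 hd1, hdx _ (by simp) d2 hd2, ex, ey] at c1
    simpa [word] using c1.symm
  subst hdd
  have hx' : Letter.x ∉ d1 := by rcases hd1 with rfl | rfl <;> simp
  have hy' : Letter.y ∉ d1 := by rcases hd1 with rfl | rfl <;> simp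
  have := eq_or_eq_of_filter_ne (x := Letter.x) (y := .y) (by simp)
    (A := wA n (N := N)) (C := wC n m) (E := d1 ++ wB ρ)
    (D := wD n m (N := N) ++ .z (N + N + 5) :: wF ρ ++ .z (N + N + 6) :: wG n m (N := N)) (v := v)
    (by simp [wC]) (by simp [wB])
    (by simp [a1, a2, a3, a4, a5, a6, hx']) (by simp [b1, b2, b3, b4, b5, b6, hy'])
    (by rw [e1, ex]; simp [word])
    (by rw [e2, ey]; simp [word])
  rcases this with h | h
  · exact ⟨_, _, Or.inl rfl, hd1, by rw [h]; simp [full, word]⟩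
  · exact ⟨_, _, Or.inr rfl, hd1, by rw [h]; simp [full, word]⟩

theorem flatMap_eq_self {L : List Letter} {φ : Letter → List Letter} (h : ∀ r ∈ L, φ r = [r]) :
    L.flatMap φ = L := by
  induction L with
  | nil => rfl
  | cons a L ih =>
    rw [List.flatMap_cons, h a (by simp), ih fun r hr => h r (by simp [hr])]
    rfl

/-- The substitution deleting all letters outside the first copy of `c_{n,m,n+m+1}[ρ]`. -/
def restrictFirst (N : ℕ) : Letter → List Letter
  | .x => [.x]
  | .y => [.y]
  | .t => [.t]
  | .z i => if i < N then [.z i] else []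
  | .s i => if i < N then [.s i] else []

/-- The shift of the letters of the first copy of `c_{n,m,n+m+1}[ρ]` to the second one. -/
def shift (N : ℕ) : Letter → Letter
  | .x => .z (N + N + 5)
  | .y => .z (N + N + 6)
  | .t => .s (N + N + 5)
  | .z i => .z (N + i)
  | .s i => .s (N + i)

/-- The substitution deleting all letters outside the second copy of `c_{n,m,n+m+1}[ρ]`, and
inverse to the shift there. -/
def restrictSecond (N : ℕ) : Letter → List Letter
  | .x => []
  | .y => []
  | .t => []
  | .z i => if i < N then [] else if i < N + N then [.z (i - N)] else
      if i = N + N + 5 then [.x] else if i = N + N + 6 then [.y] else []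
  | .s i => if i < N then [] else if i < N + N then [.s (i - N)] else
      if i = N + N + 5 then [.t] else []

theorem flatMap_restrictFirst (hN : N = n + m + (n + m + 1)) {e d : List Letter}
    (he : IsOrder .x .y e) (hd : IsOrder (.z (N + N + 5)) (.z (N + N + 6)) d) :
    (full n m ρ e d).flatMap (restrictFirst N) = pre 0 n ++ (e ++ ((.t :: pre n m) ++
      (.x :: (mid 0 ρ ++ (.y :: post (n + m) (n + m + 1)))))) := by
  have keep : ∀ L : List Letter, (∀ r ∈ L, r = .x ∨ r = .y ∨ r = .t ∨
      ∃ i, i < N ∧ (r = .z i ∨ r = .s i)) → L.flatMap (restrictFirst N) = L := by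
    intro L hL
    refine flatMap_eq_self fun r hr => ?_
    rcases hL r hr with rfl | rfl | rfl | ⟨i, hi, rfl | rfl⟩ <;> simp [restrictFirst]
    all_goals omega
  have kill : ∀ L : List Letter, (∀ r ∈ L, ∃ i, N ≤ i ∧ (r = .z i ∨ r = .s i)) →
      L.flatMap (restrictFirst N) = [] := by
    intro L hL
    refine List.flatMap_eq_nil_iff.mpr fun r hr => ?_
    obtain ⟨i, hi, rfl | rfl⟩ := hL r hr <;> simp [restrictFirst, hi]
  have k1 : ∀ a k, a + k ≤ N → (pre a k).flatMap (restrictFirst N) = pre a k := by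
    intro a k hk
    refine keep _ fun r hr => ?_
    obtain ⟨i, hi, h⟩ := mem_pre.mp hr
    exact Or.inr (Or.inr (Or.inr ⟨i, by omega, h⟩))
  have k2 : ∀ a k, N ≤ a → (pre a k).flatMap (restrictFirst N) = [] := by
    intro a k hk
    refine kill _ fun r hr => ?_
    obtain ⟨i, hi, h⟩ := mem_pre.mp hr
    exact ⟨i, by omega, h⟩
  have k3 : ∀ a k, a + k ≤ N → (post a k).flatMap (restrictFirst N) = post a k := by
    intro a k hk
    refine keep _ fun r hr => ?_
    obtain ⟨i, hi, h⟩ := mem_post.mp hr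
    exact Or.inr (Or.inr (Or.inr ⟨i, by omega, h.symm⟩))
  have k4 : ∀ a k, N ≤ a → (post a k).flatMap (restrictFirst N) = [] := by
    intro a k hk
    refine kill _ fun r hr => ?_
    obtain ⟨i, hi, h⟩ := mem_post.mp hr
    exact ⟨i, by omega, h.symm⟩
  have k5 : (mid 0 ρ).flatMap (restrictFirst N) = mid 0 ρ := by
    refine keep _ fun r hr => ?_
    obtain ⟨i, hi, h⟩ := mem_mid.mp hr
    exact Or.inr (Or.inr (Or.inr ⟨i, hi, Or.inl (by simpa using h)⟩))
  have k6 : (mid N ρ).flatMap (restrictFirst N) = [] := by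
    refine kill _ fun r hr => ?_
    obtain ⟨i, hi, h⟩ := mem_mid.mp hr
    exact ⟨N + i, by omega, Or.inl h⟩
  have k7 : e.flatMap (restrictFirst N) = e := by rcases he with rfl | rfl <;> rfl
  have k8 : d.flatMap (restrictFirst N) = [] := by
    refine kill _ fun r hr => ?_
    rcases hd with rfl | rfl <;> simp at hr <;> rcases hr with rfl | rfl
    exacts [⟨_, by omega, Or.inl rfl⟩, ⟨_, by omega, Or.inl rfl⟩, ⟨_, by omega, Or.inl rfl⟩,
      ⟨_, by omega, Or.inl rfl⟩]
  have k9 : ∀ i, N ≤ i → restrictFirst N (.z i) = [] := by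
    intro i hi; simp [restrictFirst, hi]
  have k10 : ∀ i, N ≤ i → restrictFirst N (.s i) = [] := by
    intro i hi; simp [restrictFirst, hi]
  simp only [full, word, wA, wC, wB, wD, wF, wG, List.flatMap_append, List.flatMap_cons,
    List.flatMap_nil, k1 0 n (by omega), k1 n m (by omega), k2 (N + N) 1 (by omega),
    k2 N n (by omega), k2 (N + n) m (by omega), k2 (N + N + 1) 2 (by omega),
    k3 (n + m) (n + m + 1) (by omega), k4 (N + n + m) (n + m + 1) (by omega),
    k4 (N + N + 3) 2 (by omega), k5, k6, k7, k8, k9 (N + N) (by omega),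
    k9 (N + N + 1) (by omega), k9 (N + N + 2) (by omega), k9 (N + N + 3) (by omega),
    k9 (N + N + 4) (by omega), k9 (N + N + 5) (by omega), k9 (N + N + 6) (by omega),
    k10 (N + N + 5) (by omega)]
  simp [restrictFirst]

theorem map_shift_pre (N a k : ℕ) : (pre a k).map (shift N) = pre (N + a) k := by
  have : List.range' (N + a) k = (List.range' a k).map (N + ·) := by
    rw [List.map_add_range']
  simp [pre, this, List.map_flatMap, List.flatMap_map, shift]

theorem map_shift_post (N a k : ℕ) : (post a k).map (shift N) = post (N + a) k := by
  have : List.range' (N + a) k = (List.range' a k).map (N + ·) := by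
    rw [List.map_add_range']
  simp [post, this, List.map_flatMap, List.flatMap_map, shift]

theorem map_shift_mid (N a : ℕ) {K : ℕ} (ρ : Equiv.Perm (Fin K)) :
    (mid a ρ).map (shift N) = mid (N + a) ρ := by
  simp [mid, List.map_ofFn, Function.comp_def, shift, add_assoc]

theorem flatMap_restrictSecond (hN : N = n + m + (n + m + 1)) {e d : List Letter}
    (he : IsOrder .x .y e) (hd : IsOrder .x .y d) :
    (full n m ρ e (d.map (shift N))).flatMap (restrictSecond N) = pre 0 n ++ (d ++ ((.t :: pre n m) ++
      (.x :: (mid 0 ρ ++ (.y :: post (n + m) (n + m + 1)))))) := by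
  have keep : ∀ L : List Letter, (∀ r ∈ L, r = .x ∨ r = .y ∨ r = .t ∨
      ∃ i, i < N ∧ (r = .z i ∨ r = .s i)) → (L.map (shift N)).flatMap (restrictSecond N) = L := by
    intro L hL
    rw [List.flatMap_map]
    refine flatMap_eq_self fun r hr => ?_
    rcases hL r hr with rfl | rfl | rfl | ⟨i, hi, rfl | rfl⟩ <;> simp [restrictSecond, shift]
    all_goals omega
  have kill : ∀ L : List Letter, (∀ r ∈ L, r = .t ∨
      ∃ i, (i < N ∨ N + N ≤ i ∧ i < N + N + 5) ∧ (r = .z i ∨ r = .s i)) →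
      L.flatMap (restrictSecond N) = [] := by
    intro L hL
    refine List.flatMap_eq_nil_iff.mpr fun r hr => ?_
    rcases hL r hr with rfl | ⟨i, hi, rfl | rfl⟩
    · rfl
    · simp only [restrictSecond]
      repeat' split
      all_goals first | rfl | omega
    · simp only [restrictSecond]
      repeat' split
      all_goals first | rfl | omega
  have k1 : ∀ a k, (a + k ≤ N ∨ N + N ≤ a ∧ a + k ≤ N + N + 5) →
      (pre a k).flatMap (restrictSecond N) = [] := by
    intro a k hk
    refine kill _ fun r hr => ?_
    obtain ⟨i, hi, h⟩ := mem_pre.mp hr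
    exact Or.inr ⟨i, by omega, h⟩
  have k2 : ∀ a k, a + k ≤ N → (pre (N + a) k).flatMap (restrictSecond N) = pre a k := by
    intro a k hk
    rw [← map_shift_pre]
    refine keep _ fun r hr => ?_
    obtain ⟨i, hi, h⟩ := mem_pre.mp hr
    exact Or.inr (Or.inr (Or.inr ⟨i, by omega, h⟩))
  have k3 : ∀ a k, (a + k ≤ N ∨ N + N ≤ a ∧ a + k ≤ N + N + 5) →
      (post a k).flatMap (restrictSecond N) = [] := by
    intro a k hk
    refine kill _ fun r hr => ?_
    obtain ⟨i, hi, h⟩ := mem_post.mp hr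
    exact Or.inr ⟨i, by omega, h.symm⟩
  have k4 : (post (N + n + m) (n + m + 1)).flatMap (restrictSecond N) =
      post (n + m) (n + m + 1) := by
    rw [add_assoc, ← map_shift_post]
    refine keep _ fun r hr => ?_
    obtain ⟨i, hi, h⟩ := mem_post.mp hr
    exact Or.inr (Or.inr (Or.inr ⟨i, by omega, h.symm⟩))
  have k5 : (mid 0 ρ).flatMap (restrictSecond N) = [] := by
    refine kill _ fun r hr => ?_
    obtain ⟨i, hi, h⟩ := mem_mid.mp hr
    exact Or.inr ⟨i, Or.inl hi, Or.inl (by simpa using h)⟩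
  have k6 : (mid N ρ).flatMap (restrictSecond N) = mid 0 ρ := by
    conv_lhs => rw [show mid N ρ = mid (N + 0) ρ from rfl, ← map_shift_mid]
    refine keep _ fun r hr => ?_
    obtain ⟨i, hi, h⟩ := mem_mid.mp hr
    exact Or.inr (Or.inr (Or.inr ⟨i, hi, Or.inl (by simpa using h)⟩))
  have k7 : e.flatMap (restrictSecond N) = [] := by rcases he with rfl | rfl <;> rfl
  have k8 : (d.map (shift N)).flatMap (restrictSecond N) = d := by
    refine keep _ fun r hr => ?_
    rcases hd with rfl | rfl <;> simp at hr <;> rcases hr with rfl | rfl <;> simp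
  have k9 : ∀ i, N + N ≤ i → i < N + N + 5 → restrictSecond N (.z i) = [] := by
    intro i hi hi'
    simpa using kill [.z i] (by simp; omega)
  have k10 : restrictSecond N (.z (N + N + 5)) = [.x] := by simp [restrictSecond]; omega
  have k11 : restrictSecond N (.z (N + N + 6)) = [.y] := by simp [restrictSecond]; omega
  have k12 : restrictSecond N (.s (N + N + 5)) = [.t] := by simp [restrictSecond]; omega
  have k13 : (pre N n).flatMap (restrictSecond N) = pre 0 n := k2 0 n (by omega)
  simp only [full, word, wA, wC, wB, wD, wF, wG, List.flatMap_append, List.flatMap_cons,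
    List.flatMap_nil, k1 0 n (by omega), k1 n m (by omega), k1 (N + N) 1 (by omega),
    k13, k2 n m (by omega), k1 (N + N + 1) 2 (by omega),
    k3 (n + m) (n + m + 1) (by omega), k4,
    k3 (N + N + 3) 2 (by omega), k5, k6, k7, k8, k9 (N + N) (by omega) (by omega),
    k9 (N + N + 1) (by omega) (by omega), k9 (N + N + 2) (by omega) (by omega),
    k9 (N + N + 3) (by omega) (by omega),
    k9 (N + N + 4) (by omega) (by omega), k10, k11, k12]
  simp [restrictSecond]

/-- Projection onto the first copy turns the left side into c itself and the right side into a
different word. The orders d and d' are deleted and play no role. -/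
theorem not_factorEq_swap_x (hN : N = n + m + (n + m + 1)) {d d' : List Letter}
    (hd : IsOrder (.z (N + N + 5)) (.z (N + N + 6)) d)
    (hd' : IsOrder (.z (N + N + 5)) (.z (N + N + 6)) d') :
    ¬ FactorEq (cList n m ρ) (full n m ρ [.x, .y] d) (full n m ρ [.y, .x] d') := by
  intro h
  have h1 := flatMap_restrictFirst (ρ := ρ) hN (Or.inl rfl) hd
  have h2 := flatMap_restrictFirst (ρ := ρ) hN (Or.inr rfl) hd'
  have h3 := h (restrictFirst N) (by rw [h1]; exact List.infix_rfl)
  rw [h1, h2] at h3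
  simpa using List.append_cancel_left h3

theorem not_factorEq_swap_z (hN : N = n + m + (n + m + 1)) {e e' : List Letter}
    (he : IsOrder .x .y e) (he' : IsOrder .x .y e') :
    ¬ FactorEq (cList n m ρ) (full n m ρ e [.z (N + N + 5), .z (N + N + 6)])
      (full n m ρ e' [.z (N + N + 6), .z (N + N + 5)]) := by
  intro h
  have h1 := flatMap_restrictSecond (ρ := ρ) hN he (Or.inl rfl)
  have h2 := flatMap_restrictSecond (ρ := ρ) hN he' (Or.inr rfl)
  have h3 := h (restrictSecond N) (by
    change (full n m ρ e ([Letter.x, .y].map (shift N))).flatMap _ <:+: _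
    rw [h1]; exact List.infix_rfl)
  change (full n m ρ e' ([Letter.y, .x].map (shift N))).flatMap _ =
    (full n m ρ e ([Letter.x, .y].map (shift N))).flatMap _ at h3
  rw [h1, h2] at h3
  simpa using List.append_cancel_left h3

end

/-! ### Rigidity of the exchange identities -/

theorem count_of_filter {W : List (Letter × Kind)} {p l : Letter} (hne : p ≠ l)
    (h : W.filter (fun b => b.1 = p ∨ b.1 = l) = [(p, .fst), (l, .lin), (p, .snd)]) :
    (W.map Prod.fst).count p = 2 ∧ (W.map Prod.fst).count l = 1 := by
  have h1 : (W.map Prod.fst).filter (fun r => r = p ∨ r = l) = [p, l, p] := by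
    rw [filter_map_fst, h]; rfl
  rw [← List.count_filter (p := fun r => decide (r = p ∨ r = l)) (a := p) (by simp),
    ← List.count_filter (p := fun r => decide (r = p ∨ r = l)) (a := l) (by simp), h1]
  simp [hne, hne.symm]

theorem Paired.count_le {W : List (Letter × Kind)} (h : Paired W) (p : Letter) :
    (W.map Prod.fst).count p ≤ 2 := by
  by_cases hp : p ∈ W.map Prod.fst
  · obtain ⟨b, hb, rfl⟩ := List.mem_map.mp hp
    obtain ⟨q, l, hne, hq, hf⟩ := h b hb
    obtain ⟨h1, h2⟩ := count_of_filter hne hf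
    rcases hq with hq | hq <;> rw [hq] <;> omega
  · rw [List.count_eq_zero_of_not_mem hp]; omega

theorem count_le_count_flatMap {ψ : Letter → List Letter} {f r : Letter} (h : ψ f = [r])
    (L : List Letter) : L.count f ≤ (L.flatMap ψ).count r := by
  induction L with
  | nil => simp
  | cons a L ih =>
    rw [List.flatMap_cons, List.count_append, List.count_cons]
    by_cases ha : a = f
    · subst ha; simp [h]; omega
    · simp [ha]; omega

theorem length_flatMap_le {ψ : Letter → List Letter} {L : List Letter}
    (h : ∀ r ∈ L, (ψ r).length ≤ 1) : (L.flatMap ψ).length ≤ L.length := by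
  induction L with
  | nil => simp
  | cons a L ih =>
    have h1 := ih fun r hr => h r (by simp [hr])
    have h2 := h a (by simp)
    rw [List.flatMap_cons, List.length_append, List.length_cons]
    omega

theorem exists_split_of_count {L : List Letter} {p : Letter} (h : L.count p = 2) :
    ∃ A C D, L = A ++ p :: C ++ p :: D := by
  have hp : p ∈ L := List.count_pos_iff.mp (by omega)
  obtain ⟨A, R, rfl, hA⟩ := List.eq_append_cons_of_mem hp
  rw [List.count_append, List.count_cons_self, List.count_eq_zero_of_not_mem hA] at h
  obtain ⟨C, D, rfl⟩ := List.append_of_mem (List.count_pos_iff.mp (by omega : 0 < R.count p))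
  exact ⟨A, C, D, by simp⟩

section
variable {n m N : ℕ} {ρ : Equiv.Perm (Fin N)} {e d : List Letter}

theorem full_eq_map (e d : List Letter) : full n m ρ e d =
    (wordA n m ρ e [.x] [.y] d [.z (N + N + 5)] [.z (N + N + 6)]).map Prod.fst :=
  (map_fst_wordA ..).symm

theorem count_full_le (hN : N = n + m + (n + m + 1)) (he : IsOrder .x .y e)
    (hd : IsOrder (.z (N + N + 5)) (.z (N + N + 6)) d) (p : Letter) :
    (full n m ρ e d).count p ≤ 2 := by
  rw [full_eq_map]
  exact (paired_wordA hN he.isSpot hd.isSpot).count_le p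

theorem count_full_z (hN : N = n + m + (n + m + 1)) (he : IsOrder .x .y e)
    (hd : IsOrder (.z (N + N + 5)) (.z (N + N + 6)) d) {j : ℕ} (hj : j < N + N + 7) :
    (full n m ρ e d).count (.z j) = 2 := by
  rw [full_eq_map]
  by_cases h : j < N + N + 5
  · exact (count_of_filter (by simp) (filter_wordA_idx hN he.isSpot hd.isSpot h)).1
  · have h' : (Letter.z j = .z (N + N + 5) ∨ Letter.z j = .z (N + N + 6)) := by
      simp; omega
    have hm : Letter.z j ∈ d := by
      rcases hd with rfl | rfl <;> simp <;> omega
    refine (count_of_filter (l := .s (N + N + 5)) (by simp) ?_).1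
    rw [filter_wordA_zz he.isSpot hd.isSpot hN h', (hd.isSpot.filter (by simp) hm).1,
      (hd.isSpot.filter (by simp) hm).2]
    rfl

theorem count_full_x (he : IsOrder .x .y e)
    (hd : IsOrder (.z (N + N + 5)) (.z (N + N + 6)) d) {p : Letter} (hp : p = .x ∨ p = .y) :
    (full n m ρ e d).count p = 2 := by
  rw [full_eq_map]
  have hm : p ∈ e := by
    rcases he with rfl | rfl <;> rcases hp with rfl | rfl <;> simp
  refine (count_of_filter (l := .t) (by rcases hp with rfl | rfl <;> simp) ?_).1
  rw [filter_wordA_x he.isSpot hd.isSpot hp, (he.isSpot.filter (by simp) hm).1,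
    (he.isSpot.filter (by simp) hm).2]
  rfl

/-- A letter already present to the left is at its second occurrence, and one still to come is at
its first. The chain condition then applies to the adjacent pair. -/
theorem full_adjacent (hN : N = n + m + (n + m + 1))
    (hρ : ∀ i : Fin N, (ρ i : ℕ) < n + m ↔ Odd (i : ℕ)) (he : IsOrder .x .y e)
    (hd : IsOrder (.z (N + N + 5)) (.z (N + N + 6)) d) {A D : List Letter} {r s : Letter}
    (h : full n m ρ e d = A ++ r :: s :: D) :
    ¬ (r ∈ A ∧ s ∈ A) ∧ (r ∈ D → s ∈ D → (r = .x ∧ s = .y) ∨ (r = .y ∧ s = .x) ∨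
    (r = .z (N + N + 5) ∧ s = .z (N + N + 6)) ∨
    (r = .z (N + N + 6) ∧ s = .z (N + N + 5))) := by
  rw [full_eq_map] at h
  have hchain := isChain_wordA (ρ := ρ) hN hρ he.isSpot hd.isSpot
  have hpair := paired_wordA (ρ := ρ) hN he.isSpot hd.isSpot
  generalize wordA n m ρ e [.x] [.y] d [.z (N + N + 5)] [.z (N + N + 6)] = W at *
  obtain ⟨A', R, rfl, rfl, hR⟩ := List.map_eq_append_iff.mp h
  obtain ⟨⟨p, i⟩, R', rfl, rfl, hR'⟩ := List.map_eq_cons_iff.mp hR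
  obtain ⟨⟨q, j⟩, R, rfl, rfl, rfl⟩ := List.map_eq_cons_iff.mp hR'
  have hadj : Adj N (p, i) (q, j) := by
    rw [List.isChain_append] at hchain
    exact (List.isChain_cons_cons.mp hchain.2.1).1
  have e1 := hpair.cases (A := A') (p := p) (i := i) (D := (q, j) :: R) rfl
  have e2 := hpair.cases (A := A' ++ [(p, i)]) (p := q) (i := j) (D := R) (by simp)
  constructor
  · rintro ⟨h1, h2⟩
    have hi : i = .snd := by
      rcases e1 with ⟨-, h, -⟩ | ⟨-, l, -, h, -⟩ | ⟨h, -⟩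
      · exact absurd h1 h
      · exact absurd h1 (notMem_of_filter_nil h).1
      · exact h
    have hj : j = .snd := by
      rcases e2 with ⟨-, h, -⟩ | ⟨-, l, -, h, -⟩ | ⟨h, -⟩
      · rw [List.map_append] at h
        exact absurd (List.mem_append_left _ h2) h
      · rw [List.map_append] at h
        exact absurd (List.mem_append_left _ h2) (notMem_of_filter_nil h).1
      · exact h
    exact hadj.1 ⟨hi, hj⟩
  · intro h1 h2
    have hi : i = .fst := by
      rcases e1 with ⟨-, -, h⟩ | ⟨h, -⟩ | ⟨-, l, -, -, h⟩
      · exact absurd (List.mem_cons_of_mem _ h1) h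
      · exact h
      · exact absurd (List.mem_cons_of_mem _ h1) (notMem_of_filter_nil h).1
    have hj : j = .fst := by
      rcases e2 with ⟨-, -, h⟩ | ⟨h, -⟩ | ⟨-, l, -, -, h⟩
      · exact absurd h2 h
      · exact h
      · exact absurd h2 (notMem_of_filter_nil h).1
    exact hadj.2 hi hj

/-- A substitution sending a word to a factor of the test word sends letters occurring twice to
words of length at most one. -/
theorem length_le_one_of_count (hN : N = n + m + (n + m + 1))
    (hρ : ∀ i : Fin N, (ρ i : ℕ) < n + m ↔ Odd (i : ℕ)) (he : IsOrder .x .y e)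
    (hd : IsOrder (.z (N + N + 5)) (.z (N + N + 6)) d) {a b u : List Letter}
    {ψ : Letter → List Letter} (h : a ++ u.flatMap ψ ++ b = full n m ρ e d) {p : Letter}
    (hp : u.count p = 2) : (ψ p).length ≤ 1 := by
  rcases hψ : ψ p with _ | ⟨r, _ | ⟨s, L⟩⟩
  · simp
  · simp
  -- An image with two leading letters r s would appear twice in the test word; its second
  -- appearance would give adjacent second occurrences.
  · obtain ⟨A, C, D, rfl⟩ := exists_split_of_count hp
    refine absurd ?_ (full_adjacent hN hρ he hd
      (A := a ++ A.flatMap ψ ++ r :: s :: L ++ C.flatMap ψ) (r := r) (s := s)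
      (D := L ++ D.flatMap ψ ++ b) ?_).1
    · constructor <;> simp
    · rw [← h]; simp [hψ]

/-- The letters p and q occur twice, so their images have length at most one. If one image is empty,
the exchange changes nothing. Otherwise the images are adjacent and both recur later, so they form
one of the two exceptional pairs. By `decomposition_unique` the instance lies exactly over e or over
d, and all surrounding pieces are identified. -/
theorem swap_instance (hN : N = n + m + (n + m + 1))
    (hρ : ∀ i : Fin N, (ρ i : ℕ) < n + m ↔ Odd (i : ℕ)) (he : IsOrder .x .y e)
    (hd : IsOrder (.z (N + N + 5)) (.z (N + N + 6)) d) {a b A g C E D : List Letter}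
    {p q : Letter} {ψ : Letter → List Letter} (hg : IsOrder p q g)
    (hp : (A ++ g ++ C ++ p :: E ++ q :: D).count p = 2)
    (hq : (A ++ g ++ C ++ p :: E ++ q :: D).count q = 2)
    (h : a ++ (A ++ g ++ C ++ p :: E ++ q :: D).flatMap ψ ++ b = full n m ρ e d) :
    a ++ (A ++ g.reverse ++ C ++ p :: E ++ q :: D).flatMap ψ ++ b = full n m ρ e d ∨
    (a ++ A.flatMap ψ = wA n (N := N) ∧ E.flatMap ψ = d ++ wB ρ ∧
      D.flatMap ψ ++ b = wD n m (N := N) ++ .z (N + N + 5) :: wF ρ ++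
        .z (N + N + 6) :: wG n m (N := N) ∧
      a ++ (A ++ g.reverse ++ C ++ p :: E ++ q :: D).flatMap ψ ++ b = full n m ρ e.reverse d) ∨
    (E.flatMap ψ = wF ρ ∧
      a ++ (A ++ g.reverse ++ C ++ p :: E ++ q :: D).flatMap ψ ++ b = full n m ρ e d.reverse) := by
  have lp := length_le_one_of_count hN hρ he hd h hp
  have lq := length_le_one_of_count hN hρ he hd h hq
  rcases hψp : ψ p with _ | ⟨r, _ | ⟨r', L⟩⟩
  · left; rw [← h]; rcases hg with rfl | rfl <;> simp [hψp]
  swap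
  · simp [hψp] at lp
  rcases hψq : ψ q with _ | ⟨s, _ | ⟨s', L⟩⟩
  · left; rw [← h]; rcases hg with rfl | rfl <;> simp [hψq]
  swap
  · simp [hψq] at lq
  have hg' : IsOrder r s (g.flatMap ψ) := by
    rcases hg with rfl | rfl
    · left; simp [hψp, hψq]
    · right; simp [hψp, hψq]
  have hrev : g.reverse.flatMap ψ = (g.flatMap ψ).reverse := by
    rcases hg with rfl | rfl <;> simp [hψp, hψq]
  have h' : full n m ρ e d = (a ++ A.flatMap ψ) ++ g.flatMap ψ ++ C.flatMap ψ ++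
      r :: E.flatMap ψ ++ s :: (D.flatMap ψ ++ b) := by
    rw [← h]; simp [hψp, hψq]
  have hcl : (r = .x ∧ s = .y) ∨ (r = .y ∧ s = .x) ∨
    (r = .z (N + N + 5) ∧ s = .z (N + N + 6)) ∨
    (r = .z (N + N + 6) ∧ s = .z (N + N + 5)) := by
    rcases hg' with hg' | hg' <;> rw [hg'] at h'
    · exact (full_adjacent hN hρ he hd (A := a ++ A.flatMap ψ)
        (D := C.flatMap ψ ++ r :: E.flatMap ψ ++ s :: (D.flatMap ψ ++ b))
        (by rw [h']; simp)).2 (by simp) (by simp)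
    · have := (full_adjacent hN hρ he hd (r := s) (s := r) (A := a ++ A.flatMap ψ)
        (D := C.flatMap ψ ++ r :: E.flatMap ψ ++ s :: (D.flatMap ψ ++ b))
        (by rw [h']; simp)).2 (by simp) (by simp)
      tauto
  have hout : a ++ (A ++ g.reverse ++ C ++ p :: E ++ q :: D).flatMap ψ ++ b =
      (a ++ A.flatMap ψ) ++ (g.flatMap ψ).reverse ++ C.flatMap ψ ++
      r :: E.flatMap ψ ++ s :: (D.flatMap ψ ++ b) := by
    rw [← hrev]; simp [hψp, hψq]
  rw [hout]
  right
  obtain ⟨a1, a2, a3, a4, a5, a6⟩ := notMem_pieces (ρ := ρ) hN (r := .x) (by simp)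
  obtain ⟨b1, b2, b3, b4, b5, b6⟩ := notMem_pieces (ρ := ρ) hN (r := .y) (by simp)
  obtain ⟨c1, c2, c3, c4, c5, c6⟩ := notMem_pieces (ρ := ρ) hN (r := .z (N + N + 5)) (by simp)
  obtain ⟨d1, d2, d3, d4, d5, d6⟩ := notMem_pieces (ρ := ρ) hN (r := .z (N + N + 6)) (by simp)
  rcases or_assoc.mpr hcl with hcl | hcl
  · left
    have hdx : Letter.x ∉ d := by rcases hd with rfl | rfl <;> simp
    have hdy : Letter.y ∉ d := by rcases hd with rfl | rfl <;> simp
    obtain ⟨rfl, rfl, f1, f2, f3, f4, f5⟩ := decomposition_unique (x := Letter.x) (y := .y)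
      (by simp) (A := wA n (N := N)) (C := wC n m) (E := d ++ wB ρ)
      (D := wD n m (N := N) ++ .z (N + N + 5) :: wF ρ ++ .z (N + N + 6) :: wG n m (N := N))
      (by simp [a1, a2, a3, a4, a5, a6, hdx]) (by simp [b1, b2, b3, b4, b5, b6, hdy]) he hg' hcl
      (by rw [← h']; simp [full, word])
    rw [f1, f2, f3, f4, f5]
    exact ⟨rfl, rfl, rfl, by simp [full, word]⟩
  · right
    have hdx : Letter.z (N + N + 5) ∉ e := by rcases he with rfl | rfl <;> simp
    have hdy : Letter.z (N + N + 6) ∉ e := by rcases he with rfl | rfl <;> simp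
    obtain ⟨rfl, rfl, f1, f2, f3, f4, f5⟩ := decomposition_unique
      (x := Letter.z (N + N + 5)) (y := .z (N + N + 6))
      (by simp) (A := wA n (N := N) ++ e ++ wC n m ++ [.x]) (C := wB ρ ++ .y :: wD n m (N := N))
      (E := wF ρ) (D := wG n m (N := N))
      (by simp [c1, c2, c3, c4, c5, c6, hdx]) (by simp [d1, d2, d3, d4, d5, d6, hdy]) hd hg' hcl
      (by rw [← h']; simp [full, word])
    rw [f1, f2, f3, f4, f5]
    exact ⟨rfl, by simp [full, word]⟩

theorem mem_wB {f : Letter} (hf : f ∈ wB ρ) : ∃ j, j < N + N + 1 ∧ f = .z j := by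
  simp only [wB, List.mem_cons, mem_mid] at hf
  rcases hf with rfl | ⟨i, hi, rfl⟩
  · exact ⟨_, by omega, rfl⟩
  · exact ⟨_, by omega, rfl⟩

theorem mem_wF {f : Letter} (hf : f ∈ wF ρ) : ∃ j, N ≤ j ∧ j < N + N + 5 ∧ j ≠ N + N ∧ f = .z j := by
  simp only [wF, List.mem_cons, mem_mid] at hf
  rcases hf with rfl | rfl | rfl | rfl | ⟨i, hi, rfl⟩
  · exact ⟨_, by omega, by omega, by omega, rfl⟩
  · exact ⟨_, by omega, by omega, by omega, rfl⟩
  · exact ⟨_, by omega, by omega, by omega, rfl⟩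
  · exact ⟨_, by omega, by omega, by omega, rfl⟩
  · exact ⟨_, by omega, by omega, by omega, rfl⟩

/-- The identity exchanging the first occurrences of `x` and `y` in one test word can be applied
to another one only in the same place, and only if the analogues of `x` and `y` occur in the same
order in both of them. -/
theorem swap_x_instance (hN : N = n + m + (n + m + 1))
    (hρ : ∀ i : Fin N, (ρ i : ℕ) < n + m ↔ Odd (i : ℕ)) (he : IsOrder .x .y e)
    (hd : IsOrder (.z (N + N + 5)) (.z (N + N + 6)) d) {a b e₀ d₀ : List Letter}
    {ψ : Letter → List Letter} (he₀ : IsOrder .x .y e₀)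
    (hd₀ : IsOrder (.z (N + N + 5)) (.z (N + N + 6)) d₀)
    (h : a ++ (full n m ρ e₀ d₀).flatMap ψ ++ b = full n m ρ e d) :
    a ++ (full n m ρ e₀.reverse d₀).flatMap ψ ++ b = full n m ρ e d ∨
    (d = d₀ ∧ a ++ (full n m ρ e₀.reverse d₀).flatMap ψ ++ b = full n m ρ e.reverse d) := by
  have hdec : ∀ e₀, full n m ρ e₀ d₀ = wA n (N := N) ++ e₀ ++ wC n m ++ .x :: (d₀ ++ wB ρ) ++
      .y :: (wD n m (N := N) ++ .z (N + N + 5) :: wF ρ ++ .z (N + N + 6) :: wG n m (N := N)) := by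
    intro e₀; simp [full, word]
  have cx := count_full_x (n := n) (m := m) (ρ := ρ) he₀ hd₀ (Or.inl rfl)
  have cy := count_full_x (n := n) (m := m) (ρ := ρ) he₀ hd₀ (Or.inr rfl)
  have lz : ∀ j, j < N + N + 7 → (ψ (.z j)).length ≤ 1 := fun j hj =>
    length_le_one_of_count hN hρ he hd h (count_full_z hN he₀ hd₀ hj)
  have lB : ∀ f ∈ wB ρ, (ψ f).length ≤ 1 := by
    intro f hf
    obtain ⟨j, hj, rfl⟩ := mem_wB hf
    exact lz j (by omega)
  have l5 := lz (N + N + 5) (by omega)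
  have l6 := lz (N + N + 6) (by omega)
  have lenB := length_flatMap_le lB
  rw [hdec] at h cx cy
  rw [hdec]
  rcases swap_instance hN hρ he hd he₀ cx cy h with h1 | ⟨-, h1, h2, h3⟩ | ⟨h1, -⟩
  · exact Or.inl h1
  · right
    refine ⟨?_, h3⟩
    -- The words d₀ `wB` and d `wB` have equal length, and every letter of the former contributes at
    -- most one letter. So ψ must send d₀ onto d and each analogue to a single letter.
    rw [List.flatMap_append] at h1
    have hl := congrArg List.length h1
    have ld : d.length = 2 := by rcases hd with rfl | rfl <;> rfl
    have ld₀ : (d₀.flatMap ψ).length = (ψ (.z (N + N + 5))).length +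
        (ψ (.z (N + N + 6))).length := by
      rcases hd₀ with rfl | rfl <;> simp; omega
    rw [List.length_append, List.length_append] at hl
    obtain ⟨h4, -⟩ := List.append_inj h1 (by omega)
    by_contra hne
    have hsw : ψ (.z (N + N + 5)) = [.z (N + N + 6)] ∧ ψ (.z (N + N + 6)) = [.z (N + N + 5)] := by
      obtain ⟨u, hu⟩ := List.length_eq_one_iff.mp (show (ψ (.z (N + N + 5))).length = 1 by omega)
      obtain ⟨v, hv⟩ := List.length_eq_one_iff.mp (show (ψ (.z (N + N + 6))).length = 1 by omega)
      rcases hd with rfl | rfl <;> rcases hd₀ with rfl | rfl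
      · exact absurd rfl hne
      · simp [hu, hv] at h4; simp [hu, hv, h4]
      · simp [hu, hv] at h4; simp [hu, hv, h4]
      · exact absurd rfl hne
    -- If the orders differ, ψ interchanges the analogues. Their second occurrences stand in the
    -- same order in both words, so the image would have them reversed.
    have h5 := congrArg (List.filter
      (fun r => r = Letter.z (N + N + 5) ∨ r = .z (N + N + 6))) h2
    obtain ⟨c1, c2, c3, c4, c5, c6⟩ := notMem_pieces (ρ := ρ) hN (r := .z (N + N + 5)) (by simp)
    obtain ⟨d1, d2, d3, d4, d5, d6⟩ := notMem_pieces (ρ := ρ) hN (r := .z (N + N + 6)) (by simp)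
    simp only [List.flatMap_append, List.flatMap_cons, List.filter_append, List.filter_cons,
      filter_nil_of_notMem c4 d4, filter_nil_of_notMem c5 d5, filter_nil_of_notMem c6 d6,
      hsw.1, hsw.2] at h5
    have h6 := congrArg List.length h5
    simp [-Bool.decide_or] at h6
    have z1 : ((wD n m (N := N)).flatMap ψ).filter
        (fun r => r = Letter.z (N + N + 5) ∨ r = .z (N + N + 6)) = [] :=
      List.eq_nil_of_length_eq_zero (by omega)
    simp [-Bool.decide_or, z1] at h5
  -- The N + 3 letters of d₀ `wB`, each with image of length at most one, cannot cover the N + 4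
  -- letters of `wF`.
  · exfalso
    have hl := congrArg List.length h1
    have ld₀ : (d₀.flatMap ψ).length = (ψ (.z (N + N + 5))).length +
        (ψ (.z (N + N + 6))).length := by
      rcases hd₀ with rfl | rfl <;> simp; omega
    rw [List.flatMap_append, List.length_append] at hl
    simp only [wB, wF, List.length_cons, mid, List.length_ofFn] at hl lenB
    omega

/-- The identity exchanging the first occurrences of the analogues of `x` and `y` in one test
word can be applied to another one only in the same place. -/
theorem swap_z_instance (hN : N = n + m + (n + m + 1))
    (hρ : ∀ i : Fin N, (ρ i : ℕ) < n + m ↔ Odd (i : ℕ)) (he : IsOrder .x .y e)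
    (hd : IsOrder (.z (N + N + 5)) (.z (N + N + 6)) d) {a b e₀ d₀ : List Letter}
    {ψ : Letter → List Letter} (he₀ : IsOrder .x .y e₀)
    (hd₀ : IsOrder (.z (N + N + 5)) (.z (N + N + 6)) d₀)
    (h : a ++ (full n m ρ e₀ d₀).flatMap ψ ++ b = full n m ρ e d) :
    a ++ (full n m ρ e₀ d₀.reverse).flatMap ψ ++ b = full n m ρ e d ∨
    a ++ (full n m ρ e₀ d₀.reverse).flatMap ψ ++ b = full n m ρ e d.reverse := by
  have hdec : ∀ d₀, full n m ρ e₀ d₀ = (wA n (N := N) ++ e₀ ++ wC n m ++ [.x]) ++ d₀ ++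
      (wB ρ ++ .y :: wD n m (N := N)) ++ .z (N + N + 5) :: wF ρ ++
      .z (N + N + 6) :: wG n m (N := N) := by
    intro e₀; simp [full, word]
  have cz := fun j (hj : j < N + N + 7) => count_full_z (n := n) (m := m) (ρ := ρ) hN he₀ hd₀ hj
  have lz : ∀ j, j < N + N + 7 → (ψ (.z j)).length ≤ 1 := fun j hj =>
    length_le_one_of_count hN hρ he hd h (cz j hj)
  rw [hdec] at h
  simp only [hdec d₀] at cz
  rw [hdec]
  rcases swap_instance hN hρ he hd hd₀ (cz _ (by omega)) (cz _ (by omega)) h with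
    h1 | ⟨h1, h2, -, -⟩ | ⟨-, h1⟩
  · exact Or.inl h1
  swap
  · exact Or.inr h1
  exfalso
  -- In this case `wF` is mapped onto d `wB`, and everything before d₀ into `wA`. A letter z_j
  -- common to `wA` and `wB` is the image of a letter of `wF`. If that letter did not occur before
  -- d₀, both of its occurrences would yield z_j after `wA`, making three occurrences of z_j. The
  -- letters of `wF` occurring before d₀ are z_{N+i} with i < n.
  have key : ∀ j, (j = N + N ∨ j < n) → ∃ i, i < n ∧ ψ (.z (N + i)) = [.z j] := by
    intro j hj
    have hjA : Letter.z j ∈ wA n (N := N) := by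
      simp only [wA, List.mem_append, mem_pre]
      rcases hj with rfl | hj
      · exact Or.inr (Or.inl ⟨_, by omega, Or.inl rfl⟩)
      · exact Or.inl ⟨_, by omega, Or.inl rfl⟩
    have hjB : Letter.z j ∈ wB ρ := by
      simp only [wB, List.mem_cons, mem_mid]
      rcases hj with rfl | hj
      · exact Or.inl rfl
      · exact Or.inr ⟨j, by omega, by simp⟩
    have hjF : Letter.z j ∈ (wF ρ).flatMap ψ := by rw [h2]; simp [hjB]
    obtain ⟨f, hf, hfj⟩ := List.mem_flatMap.mp hjF
    obtain ⟨i, hi1, hi2, hi3, rfl⟩ := mem_wF hf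
    have hψ : ψ (.z i) = [.z j] := by
      have hl := lz i (by omega)
      rcases hL : ψ (.z i) with _ | ⟨r, _ | ⟨s, L⟩⟩
      · simp [hL] at hfj
      · simp [hL] at hfj; simp [hfj]
      · simp [hL] at hl
    by_cases hiA : Letter.z i ∈ wA n (N := N) ++ e₀ ++ wC n m ++ [.x]
    · have hie : Letter.z i ∉ e₀ := by rcases he₀ with rfl | rfl <;> simp
      simp only [wA, wC, List.mem_append, List.mem_cons, mem_pre, hie] at hiA
      refine ⟨i - N, ?_, by rw [show N + (i - N) = i by omega]; exact hψ⟩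
      simp at hiA
      omega
    · exfalso
      have h3 := cz i (by omega)
      have h4 := count_full_le (ρ := ρ) hN he hd (.z j)
      have h5 : ∀ A g C E D : List Letter, A ++ g ++ C ++ E ++ D = A ++ (g ++ C ++ E ++ D) := by simp
      rw [h5, List.count_append, List.count_eq_zero_of_not_mem hiA, zero_add] at h3
      rw [← h, h5, List.flatMap_append, List.append_assoc, List.append_assoc, ← List.append_assoc,
        h1, List.count_append, List.count_append] at h4
      have h6 := count_le_count_flatMap hψ (d₀ ++ (wB ρ ++ .y :: wD n m (N := N)) ++
        .z (N + N + 5) :: wF ρ ++ .z (N + N + 6) :: wG n m (N := N))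
      have h7 := List.count_pos_iff.mpr hjA
      omega
  -- Pigeonhole: n + 1 letters would be images of n letters.
  have hcard := Finset.card_le_card (s := (insert (N + N) (Finset.range n)).image
      (fun j => [Letter.z j])) (t := (Finset.range n).image (fun i => ψ (.z (N + i)))) (by
    intro l hl
    simp only [Finset.mem_image, Finset.mem_insert, Finset.mem_range] at hl ⊢
    obtain ⟨j, hj, rfl⟩ := hl
    exact key j hj)
  rw [Finset.card_image_of_injective _ (by intro u v huv; simpa using huv),
    Finset.card_insert_of_notMem (by simp; omega), Finset.card_range] at hcard
  have := hcard.trans Finset.card_image_le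
  simp at this

end

/-! ### Syntactic monoids and factor monoids -/

/-- The syntactic congruence of a language. -/
def syntacticCon (L : Set (List Letter)) : Con Word where
  r u v := ∀ a b : Word, (a * u * b).toList ∈ L ↔ (a * v * b).toList ∈ L
  iseqv := ⟨fun _ _ _ => Iff.rfl, fun h a b => (h a b).symm, fun h k a b => (h a b).trans (k a b)⟩
  mul' := by
    intro u v u' v' h k a b
    have h1 := h a (u' * b)
    have h2 := k (a * v) b
    simp only [mul_assoc] at h1 h2 ⊢
    exact h1.trans h2

/-- The syntactic monoid of a language. -/
def syntactic (L : Set (List Letter)) : MonCat.{0} := MonCat.of (syntacticCon L).Quotient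

theorem toList_lift (ψ : Letter → Word) (u : Word) :
    (FreeMonoid.lift ψ u).toList = u.toList.flatMap fun l => (ψ l).toList := by
  induction u using FreeMonoid.recOn with
  | one => simp
  | of_mul a u ih => simp [ih]

/-- Every assignment into the quotient lifts to words through representatives, so validity of the
identity means that L is invariant under replacing an instance of one side by the other in any
context. -/
theorem satisfies_syntactic {L : Set (List Letter)} {e : Word × Word} :
    Satisfies (syntactic L) e ↔ ∀ (ψ : Letter → List Letter) (a b : List Letter),
      a ++ e.1.toList.flatMap ψ ++ b ∈ L ↔ a ++ e.2.toList.flatMap ψ ++ b ∈ L := by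
  have hlift : ∀ (ψ : Letter → Word) (u : Word),
      FreeMonoid.lift (fun l => ((ψ l : Word) : (syntacticCon L).Quotient)) u =
        ((FreeMonoid.lift ψ u : Word) : (syntacticCon L).Quotient) := by
    intro ψ u
    have : FreeMonoid.lift (fun l => ((ψ l : Word) : (syntacticCon L).Quotient)) =
        (syntacticCon L).mk'.comp (FreeMonoid.lift ψ) := FreeMonoid.hom_eq fun l => by simp
    rw [this]; rfl
  have hcong : ∀ ψ : Letter → Word,
      FreeMonoid.lift (fun l => ((ψ l : Word) : (syntacticCon L).Quotient)) e.1 =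
        FreeMonoid.lift (fun l => ((ψ l : Word) : (syntacticCon L).Quotient)) e.2 ↔
      ∀ a b : Word, (a * FreeMonoid.lift ψ e.1 * b).toList ∈ L ↔
        (a * FreeMonoid.lift ψ e.2 * b).toList ∈ L := by
    intro ψ
    rw [hlift, hlift]
    exact (syntacticCon L).eq
  constructor
  · intro h ψ a b
    have := (hcong fun l => FreeMonoid.ofList (ψ l)).mp (h _) (FreeMonoid.ofList a)
      (FreeMonoid.ofList b)
    simpa [toList_lift] using this
  · intro h φ
    obtain ⟨ψ, rfl⟩ : ∃ ψ : Letter → Word, φ = fun l => ((ψ l : Word) : (syntacticCon L).Quotient) :=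
      ⟨fun l => (φ l).out, funext fun l => (Quotient.out_eq _).symm⟩
    refine (hcong ψ).mpr fun a b => ?_
    have := h (fun l => (ψ l).toList) a.toList b.toList
    simpa [toList_lift] using this

/-- The map from words to a factor monoid, as a homomorphism. -/
noncomputable def FactorMonoid.ofWordHom (W : Set Word) : Word →* FactorMonoid W where
  toFun := ofWord W
  map_one' := dif_pos (Or.inl rfl)
  map_mul' := by
    intro u v
    by_cases h : IsFactor W u
    · have : ofWord W u = some ⟨u, h⟩ := dif_pos h
      rw [this]
      exact (mul_ofWord ⟨u, h⟩ v).symm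
    · have h1 : ofWord W u = none := dif_neg h
      have h2 : ofWord W (u * v) = none := dif_neg fun k => h k.left
      rw [h1, h2]; rfl

theorem FactorMonoid.ofWord_inj {W : Set Word} {u v : Word} (hu : IsFactor W u)
    (h : ofWord W u = ofWord W v) : u = v := by
  have h1 : ofWord W u = some ⟨u, hu⟩ := dif_pos hu
  by_cases hv : IsFactor W v
  · have h2 : ofWord W v = some ⟨v, hv⟩ := dif_pos hv
    rw [h1, h2] at h
    exact congrArg Subtype.val (Option.some.inj h)
  · have h2 : ofWord W v = none := dif_neg hv
    rw [h1, h2] at h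
    cases h

/-- Consequences of an identity of the factor monoid of `c` are indistinguishable by substitutions
into `c`. -/
theorem factorEq_of_satisfies {c : Word} {e : Word × Word}
    (h : Satisfies (MonCat.of (FactorMonoid {c})) e) (ψ : Letter → List Letter)
    (a b : List Letter) :
    FactorEq c.toList (a ++ e.1.toList.flatMap ψ ++ b) (a ++ e.2.toList.flatMap ψ ++ b) := by
  intro φ hφ
  have hlift : ∀ u : Word, FreeMonoid.lift
      (fun l => FactorMonoid.ofWord {c} (FreeMonoid.ofList ((ψ l).flatMap φ))) u =
      FactorMonoid.ofWord {c} (FreeMonoid.lift (fun l => FreeMonoid.ofList ((ψ l).flatMap φ)) u) := by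
    intro u
    have : FreeMonoid.lift (fun l => FactorMonoid.ofWord {c} (FreeMonoid.ofList ((ψ l).flatMap φ))) =
        (FactorMonoid.ofWordHom {c}).comp
          (FreeMonoid.lift fun l => FreeMonoid.ofList ((ψ l).flatMap φ)) :=
      FreeMonoid.hom_eq fun l => by
        simp only [FreeMonoid.lift_eval_of, MonoidHom.comp_apply]; rfl
    rw [this]; rfl
  have h1 := h fun l => FactorMonoid.ofWord {c} (FreeMonoid.ofList ((ψ l).flatMap φ))
  have h2 := (hlift e.1).symm.trans (h1.trans (hlift e.2))
  obtain ⟨A, D, hA⟩ := hφ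
  -- A factor of a factor: the image of the left side is nonzero in the factor monoid, where
  -- equality of nonzero values is equality of words.
  have hfac : IsFactor {c} (FreeMonoid.lift (fun l => FreeMonoid.ofList ((ψ l).flatMap φ)) e.1) := by
    refine Or.inr ⟨c, rfl, FreeMonoid.ofList (A ++ a.flatMap φ),
      FreeMonoid.ofList (b.flatMap φ ++ D), ?_⟩
    apply FreeMonoid.toList.injective
    rw [← hA]
    simp [toList_lift, List.flatMap_assoc]
  have h3 := congrArg FreeMonoid.toList (FactorMonoid.ofWord_inj hfac h2)
  simp only [toList_lift, FreeMonoid.toList_ofList] at h3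
  simp only [List.flatMap_append, List.flatMap_assoc, h3]

/-! ### Failure of the modular law -/

namespace Variety

/-- The variety defined by a set of identities. -/
def ofIdentities (E : Set (Word × Word)) : Variety := ⟨models E, E, rfl⟩

theorem mem_inf {U V : Variety} {M : MonCat.{0}} :
    M ∈ (U ⊓ V).carrier ↔ M ∈ U.carrier ∧ M ∈ V.carrier := by
  constructor
  · intro h
    exact ⟨(inf_le_left : U ⊓ V ≤ U) h, (inf_le_right : U ⊓ V ≤ V) h⟩
  · rintro ⟨h1, h2⟩ W (rfl | rfl)
    · exact h1
    · exact h2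

theorem mem_generatedBy {M K : MonCat.{0}} (h : ∀ e, Satisfies M e → Satisfies K e) :
    K ∈ (generatedBy M).carrier := by
  intro V hV
  obtain ⟨E, hE⟩ := V.equational
  have hM : M ∈ V.carrier := hV
  rw [hE] at hM ⊢
  exact fun e he => h e (hM e he)

/-- A language in the intersection of two languages recognised by syntactic monoids in two
varieties has its syntactic monoid in their join. -/
theorem syntactic_inter_mem_sup {U V : Variety} {L K : Set (List Letter)}
    (hL : syntactic L ∈ U.carrier) (hK : syntactic K ∈ V.carrier) :
    syntactic (L ∩ K) ∈ (U ⊔ V).carrier := by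
  obtain ⟨E, hE⟩ := (U ⊔ V).equational
  have h1 := (le_sup_left : U ≤ U ⊔ V) hL
  have h2 := (le_sup_right : V ≤ U ⊔ V) hK
  rw [hE] at h1 h2 ⊢
  intro e he
  rw [satisfies_syntactic]
  intro ψ a b
  exact and_congr (satisfies_syntactic.mp (h1 e he) ψ a b) (satisfies_syntactic.mp (h2 e he) ψ a b)

/-- Four words whose syntactic monoids yield a failure of the modular law below `V`. -/
theorem exists_not_sup_inf_le {V : Variety} {w₁ w₂ w₃ w₄ : Word} (h14 : w₁ ≠ w₄) (h34 : w₃ ≠ w₄)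
    (hV₃ : syntactic {w₃.toList} ∈ V.carrier)
    (hV₃₄ : syntactic {w₃.toList, w₄.toList} ∈ V.carrier)
    (hV₁₃ : syntactic {w₁.toList, w₃.toList} ∈ V.carrier)
    (hZ : Satisfies (syntactic {w₃.toList}) (w₁, w₂))
    (hX : Satisfies (syntactic {w₃.toList, w₄.toList}) (w₁, w₂))
    (hX' : Satisfies (syntactic {w₃.toList, w₄.toList}) (w₃, w₄))
    (hY : Satisfies (syntactic {w₁.toList, w₃.toList}) (w₁, w₃))
    (hY' : Satisfies (syntactic {w₁.toList, w₃.toList}) (w₂, w₄)) :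
    ∃ X Y Z : V.Subvarieties, X ≤ Z ∧ ¬ (X ⊔ Y) ⊓ Z ≤ X ⊔ Y ⊓ Z := by
  let Z : Variety := V ⊓ ofIdentities {(w₁, w₂)}
  let X : Variety := Z ⊓ ofIdentities {(w₃, w₄)}
  let Y : Variety := V ⊓ ofIdentities {(w₁, w₃), (w₂, w₄)}
  have hXZ : X ≤ Z := inf_le_left
  have hZV : Z ≤ V := inf_le_left
  refine ⟨⟨X, hXZ.trans hZV⟩, ⟨Y, (inf_le_left : Y ≤ V)⟩, ⟨Z, hZV⟩, hXZ, fun hle => ?_⟩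
  replace hle : (X ⊔ Y) ⊓ Z ≤ X ⊔ Y ⊓ Z := hle
  have hZm : syntactic {w₃.toList} ∈ Z.carrier := mem_inf.mpr ⟨hV₃, by rintro _ rfl; exact hZ⟩
  have hXm : syntactic {w₃.toList, w₄.toList} ∈ X.carrier :=
    mem_inf.mpr ⟨mem_inf.mpr ⟨hV₃₄, by rintro _ rfl; exact hX⟩, by rintro _ rfl; exact hX'⟩
  have hYm : syntactic {w₁.toList, w₃.toList} ∈ Y.carrier :=
    mem_inf.mpr ⟨hV₁₃, by rintro _ (rfl | rfl); exacts [hY, hY']⟩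
  have hXY := syntactic_inter_mem_sup hXm hYm
  have hint : ({w₃.toList, w₄.toList} ∩ {w₁.toList, w₃.toList} : Set (List Letter)) =
      {w₃.toList} := by
    ext u
    simp only [Set.mem_inter_iff, Set.mem_insert_iff, Set.mem_singleton_iff]
    constructor
    · rintro ⟨h | h, k | k⟩
      · exact h
      · exact h
      · exact absurd (FreeMonoid.toList.injective (k.symm.trans h)) h14
      · exact k
    · rintro rfl
      exact ⟨Or.inl rfl, Or.inr rfl⟩
  rw [hint] at hXY
  -- X satisfies this identity by definition; in Y ⊓ Z it follows from w₃ ≈ w₁ ≈ w₂ ≈ w₄.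
  have hup : X ⊔ Y ⊓ Z ≤ ofIdentities {(w₃, w₄)} := by
    refine sup_le inf_le_right fun M hM => ?_
    obtain ⟨hMY, hMZ⟩ := mem_inf.mp hM
    have h1 : Satisfies M (w₁, w₂) := (mem_inf.mp hMZ).2 _ rfl
    have h2 : Satisfies M (w₁, w₃) := (mem_inf.mp hMY).2 _ (Or.inl rfl)
    have h3 : Satisfies M (w₂, w₄) := (mem_inf.mp hMY).2 _ (Or.inr rfl)
    rintro _ rfl φ
    exact (h2 φ).symm.trans ((h1 φ).trans (h3 φ))
  have hfin : Satisfies (syntactic {w₃.toList}) (w₃, w₄) :=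
    hup (hle (mem_inf.mpr ⟨hXY, hZm⟩)) _ rfl
  have := (satisfies_syntactic.mp hfin (fun l => [l]) [] []).mp (by simp)
  simp only [List.nil_append, List.append_nil, List.flatMap_singleton', Set.mem_singleton_iff] at this
  exact h34 (FreeMonoid.toList.injective this.symm)

end Variety

/-- Although `FactorEq` is one-sided, closure in one direction is enough: the identities of the
factor monoid are symmetric, and the converse uses the reversed identity. -/
theorem syntactic_mem_factorVariety {c : Word} {L : Set (List Letter)}
    (h : ∀ u v, FactorEq c.toList u v → u ∈ L → v ∈ L) :
    syntactic L ∈ (factorVariety {c}).carrier := by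
  refine Variety.mem_generatedBy fun e he => satisfies_syntactic.mpr fun ψ a b => ⟨?_, ?_⟩
  · exact h _ _ (factorEq_of_satisfies he ψ a b)
  · exact h _ _ (factorEq_of_satisfies (e := (e.2, e.1)) (fun φ => (he φ).symm) ψ a b)

theorem exists_not_sup_inf_le_cWord (n m : ℕ) (ρ : Equiv.Perm (Fin (n + m + (n + m + 1))))
    (hρ : IsAlternatingPerm (n + m) (n + m + 1) ρ) :
    ∃ X Y Z : (factorVariety {cWord n m (n + m + 1) ρ}).Subvarieties,
      X ≤ Z ∧ ¬ (X ⊔ Y) ⊓ Z ≤ X ⊔ Y ⊓ Z := by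
  obtain ⟨N, hN⟩ : ∃ N, N = n + m + (n + m + 1) := ⟨_, rfl⟩
  have hρ' := lt_iff_odd_of_alternating rfl hρ
  have hc := toList_cWord n m ρ
  generalize hV : cWord n m (n + m + 1) ρ = c at *
  clear hV hρ
  subst hN
  set z : Letter := .z (n + m + (n + m + 1) + (n + m + (n + m + 1)) + 5) with hz
  set w : Letter := .z (n + m + (n + m + 1) + (n + m + (n + m + 1)) + 6) with hw
  have o1 : IsOrder Letter.x .y [.x, .y] := Or.inl rfl
  have o2 : IsOrder Letter.x .y [.y, .x] := Or.inr rfl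
  have o3 : IsOrder z w [z, w] := Or.inl rfl
  have o4 : IsOrder z w [w, z] := Or.inr rfl
  have hzw : z ≠ w := by simp [hz, hw]
  have hzz : [z, w] ≠ [w, z] := fun h => hzw (List.cons.inj h).1
  have hne1 : full n m ρ [.x, .y] [w, z] ≠ full n m ρ [.y, .x] [z, w] := fun h => by
    simp [full, word, hzw.symm] at h
  have hne2 : full n m ρ [.x, .y] [z, w] ≠ full n m ρ [.y, .x] [z, w] := fun h => by
    simp [full, word] at h
  have hX : ∀ (ψ : Letter → List Letter) (a b e₀ d₀ : List Letter), IsOrder .x .y e₀ →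
      IsOrder z w d₀ → a ++ (full n m ρ e₀ d₀).flatMap ψ ++ b ∈
        ({full n m ρ [.x, .y] [z, w], full n m ρ [.y, .x] [z, w]} : Set (List Letter)) →
      a ++ (full n m ρ e₀.reverse d₀).flatMap ψ ++ b ∈
        ({full n m ρ [.x, .y] [z, w], full n m ρ [.y, .x] [z, w]} : Set (List Letter)) := by
    rintro ψ a b e₀ d₀ he₀ hd₀ (h | h)
    · rcases swap_x_instance rfl hρ' o1 o3 he₀ hd₀ h with h | ⟨-, h⟩
      exacts [Or.inl h, Or.inr h]
    · rcases swap_x_instance rfl hρ' o2 o3 he₀ hd₀ h with h | ⟨-, h⟩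
      exacts [Or.inr h, Or.inl h]
  have hY : ∀ (ψ : Letter → List Letter) (a b e₀ d₀ : List Letter), IsOrder .x .y e₀ →
      IsOrder z w d₀ → a ++ (full n m ρ e₀ d₀).flatMap ψ ++ b ∈
        ({full n m ρ [.x, .y] [w, z], full n m ρ [.x, .y] [z, w]} : Set (List Letter)) →
      a ++ (full n m ρ e₀ d₀.reverse).flatMap ψ ++ b ∈
        ({full n m ρ [.x, .y] [w, z], full n m ρ [.x, .y] [z, w]} : Set (List Letter)) := by
    rintro ψ a b e₀ d₀ he₀ hd₀ (h | h)
    · rcases swap_z_instance rfl hρ' o1 o4 he₀ hd₀ h with h | h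
      exacts [Or.inl h, Or.inr h]
    · rcases swap_z_instance rfl hρ' o1 o3 he₀ hd₀ h with h | h
      exacts [Or.inr h, Or.inl h]
  -- The four words form a square: w₁ ≈ w₂ and w₃ ≈ w₄ exchange x and y, while w₁ ≈ w₃ and w₂ ≈ w₄
  -- exchange the analogues.
  refine Variety.exists_not_sup_inf_le (w₁ := .ofList (full n m ρ [.x, .y] [w, z]))
    (w₂ := .ofList (full n m ρ [.y, .x] [w, z])) (w₃ := .ofList (full n m ρ [.x, .y] [z, w]))
    (w₄ := .ofList (full n m ρ [.y, .x] [z, w])) (fun h => hne1 (FreeMonoid.ofList.injective h))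
    (fun h => hne2 (FreeMonoid.ofList.injective h)) ?_ ?_ ?_ ?_ ?_ ?_ ?_ ?_
  · refine syntactic_mem_factorVariety fun u v h hu => ?_
    rw [hc] at h
    obtain rfl : u = _ := hu
    obtain ⟨e', d', rfl | rfl, rfl | rfl, rfl⟩ := h.eq_full rfl hρ' o1 o3
    · rfl
    · exact absurd h (not_factorEq_swap_z rfl o1 o1)
    · exact absurd h (not_factorEq_swap_x rfl o3 o3)
    · exact absurd h (not_factorEq_swap_x rfl o3 o4)
  · refine syntactic_mem_factorVariety fun u v h hu => ?_
    rw [hc] at h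
    obtain ⟨e, he, rfl⟩ : ∃ e, IsOrder .x .y e ∧ u = full n m ρ e [z, w] := by
      rcases hu with hu | hu
      exacts [⟨_, o1, hu⟩, ⟨_, o2, hu⟩]
    obtain ⟨e', d', he', rfl | rfl, rfl⟩ := h.eq_full rfl hρ' he o3
    · rcases he' with rfl | rfl
      exacts [Or.inl rfl, Or.inr rfl]
    · exact absurd h (not_factorEq_swap_z rfl he he')
  · refine syntactic_mem_factorVariety fun u v h hu => ?_
    rw [hc] at h
    obtain ⟨d, hd, rfl⟩ : ∃ d, IsOrder z w d ∧ u = full n m ρ [.x, .y] d := by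
      rcases hu with hu | hu
      exacts [⟨_, o4, hu⟩, ⟨_, o3, hu⟩]
    obtain ⟨e', d', rfl | rfl, hd', rfl⟩ := h.eq_full rfl hρ' o1 hd
    · rcases hd' with rfl | rfl
      exacts [Or.inr rfl, Or.inl rfl]
    · exact absurd h (not_factorEq_swap_x rfl hd hd')
  -- The identity w₁ ≈ w₂ carries the order wz, whereas w₃ carries zw. So none of its instances can
  -- change w₃.
  · refine satisfies_syntactic.mpr fun ψ a b => ⟨fun h => ?_, fun h => ?_⟩
    · rcases swap_x_instance rfl hρ' o1 o3 o1 o4 h with h | ⟨h, -⟩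
      exacts [h, absurd h hzz]
    · rcases swap_x_instance rfl hρ' o1 o3 o2 o4 h with h | ⟨h, -⟩
      exacts [h, absurd h hzz]
  · exact satisfies_syntactic.mpr fun ψ a b => ⟨hX ψ a b _ _ o1 o4, hX ψ a b _ _ o2 o4⟩
  · exact satisfies_syntactic.mpr fun ψ a b => ⟨hX ψ a b _ _ o1 o3, hX ψ a b _ _ o2 o3⟩
  · exact satisfies_syntactic.mpr fun ψ a b => ⟨hY ψ a b _ _ o1 o4, hY ψ a b _ _ o1 o3⟩
  · exact satisfies_syntactic.mpr fun ψ a b => ⟨hY ψ a b _ _ o2 o4, hY ψ a b _ _ o2 o3⟩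

end MonVar

theorem mainTheorem4 (n m : ℕ) (ρ : Equiv.Perm (Fin (n + m + (n + m + 1))))
    (hρ : MonVar.IsAlternatingPerm (n + m) (n + m + 1) ρ) :
    ¬ IsModularLattice
        (MonVar.factorVariety {MonVar.cWord n m (n + m + 1) ρ}).Subvarieties ∧
    ¬ ∀ X Y Z : (MonVar.factorVariety {MonVar.cWord n m (n + m + 1) ρ}).Subvarieties,
        X ⊓ (Y ⊔ Z) = (X ⊓ Y) ⊔ (X ⊓ Z) := by
  obtain ⟨X, Y, Z, hXZ, h⟩ := MonVar.exists_not_sup_inf_le_cWord n m ρ hρ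
  refine ⟨fun hmod => h (hmod.sup_inf_le_assoc_of_le Y hXZ), fun hdist => h ?_⟩
  rw [inf_comm, hdist Z X Y, inf_eq_right.mpr hXZ, inf_comm Z Y]
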